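/- **Proposition (Grassmann-algebra version, Voronov).** Let $p,q,m,n\ge 0$. For $N\ge 0$ let $\Lambda_N=\Lambda(\epsilon_1,\dots,\epsilon_N)=\Lambda_{N,0}\oplus\Lambda_{N,1}$ be the real Grassmann algebra in $N$ odd generators, and let $\mathbf{\Lambda}$ be the category of these algebras with parity-preserving unital algebra morphisms. For $a\in\Lambda_N$ write $a=\tilde a+\mathring a$ with $\tilde a\in\mathbb R$ and $\mathring a$ nilpotent. Let $\mathbb R^{p|q}$ be the supermanifold $\mathbb R^p$ with structure sheaf $U\mapsto \mathcal O(U)=C^\infty(U)\otimes\Lambda(\theta_1,\dots,\theta_q)$, let $\mathbb R^{p|q}_\Lambda=\mathrm{Hom}_{\mathrm{SAlg}}(\mathcal O(\mathbb R^p),\Lambda)$ be its set of $\Lambda$-points, a functor of $\Lambda\in\mathbf\Lambda$ with values in sets, and identify $\mathbb R^{p|q}_\Lambda$ with $\Lambda_0^p\times\Lambda_1^q$ by sending a $\Lambda$-point to the images $(\mathrm x_1,\dots,\mathrm x_p,\vartheta_1,\dots,\vartheta_q)$ of the coordinates $x_1,\dots,x_p,\theta_1,\dots,\theta_q$. Let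 $\mathcal F_{p|q}$ be the set of formal series $F=\sum_{\nu\in\mathbb N^p,\,J\subseteq\{1,\dots,q\}} f_{\nu,J}X^\nu\Theta^J$ whose coefficients $f_{\nu,J}:\mathbb R^p\to\mathbb R$ are arbitrary functions; $F$ is even (in $(\mathcal F_{p|q})_0$), respectively odd (in $(\mathcal F_{p|q})_1$), if only $J$ with $|J|$ even, respectively odd, occur. 1. The natural transformations $\alpha$ from $\Lambda\mapsto\mathbb R^{p|q}_\Lambda$ to $\Lambda\mapsto\mathbb R^{m|n}_\Lambda$ on $\mathbf\Lambda$ are in bijective correspondence with the tuples $(F_1,\dots,F_{m+n})\in(\mathcal F_{p|q})_0^m\times(\mathcal F_{p|q})_1^n$, where $\alpha$ and $(F_k)$, $F_k=\sum f^k_{\nu,J}X^\nu\Theta^J$, correspond to each other when, for every $\Lambda$, every $\Lambda$-point and every $k$, the $k$-th coordinate of its image under $\alpha_\Lambda$ is $$\sum_{\nu,J} f^k_{\nu,J}(\tilde{\mathrm x}_1,\dots,\tilde{\mathrm x}_p)\,\mathring{\mathrm x}^\nu\,\vartheta^J .$$ 2. Such an $\alpha$ comes from a morphism of supermanifolds $\varphi:\mathbb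 R^{p|q}\to\mathbb R^{m|n}$ (that is, $\alpha_\Lambda(x)=x\circ\varphi^*$ for all $\Lambda$ and all $x\in\mathbb R^{p|q}_\Lambda$) if and only if for every $\Lambda$ the map $\alpha_\Lambda:\Lambda_0^p\times\Lambda_1^q\to\Lambda_0^m\times\Lambda_1^n$ is $\Lambda_0$-smooth, i.e. smooth with $\Lambda_0$-linear differential at every point. -/

import Mathlib

open CategoryTheory TopologicalSpace
open scoped Manifold ContDiff TensorProduct

noncomputable section

namespace Super

/-! ### Finite-dimensional Grassmann algebras -/

/-- The real Grassmann algebra `Λ_N` in `N` odd generators. -/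
abbrev Gr (N : ℕ) : Type := ExteriorAlgebra ℝ (Fin N → ℝ)

/-- The `ℤ/2`-grading of the Grassmann algebra: `Gr.parity N 0` is the even part and
`Gr.parity N 1` the odd part. -/
abbrev Gr.parity (N : ℕ) : ZMod 2 → Submodule ℝ (Gr N) :=
  CliffordAlgebra.evenOdd (0 : QuadraticForm ℝ (Fin N → ℝ))

/-- The `i`-th odd generator of `Λ_N`. -/
def Gr.gen {N : ℕ} (i : Fin N) : Gr N := ExteriorAlgebra.ι ℝ (Pi.single i (1 : ℝ))

/-- The body of an element of `Λ_N`: its image under the projection `Λ_N → ℝ` that kills the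
generators. -/
def Gr.body {N : ℕ} : Gr N →ₐ[ℝ] ℝ := ExteriorAlgebra.algebraMapInv

/-- The nilpotent part `a - body a` of an element of `Λ_N`. -/
def Gr.nil {N : ℕ} (a : Gr N) : Gr N := a - algebraMap ℝ (Gr N) (Gr.body a)

/-- The monomial basis of `Λ_N`, indexed by the subsets of the set of generators. -/
def Gr.monomialBasis (N : ℕ) : Module.Basis (Finset (Fin N)) ℝ (Gr N) :=
  (Pi.basisFun ℝ (Fin N)).ExteriorAlgebra

/-- A norm on the finite-dimensional real vector space `Λ_N` (the largest absolute value of a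
coefficient in the monomial basis). It only serves to speak of smooth maps between finite-dimensional
real vector spaces, for which the choice of the norm is irrelevant. -/
abbrev Gr.normedAddCommGroup (N : ℕ) : NormedAddCommGroup (Gr N) :=
  NormedAddCommGroup.induced (Gr N) (Finset (Fin N) → ℝ)
    (Gr.monomialBasis N).equivFun.toLinearMap (Gr.monomialBasis N).equivFun.injective

attribute [local instance] Gr.normedAddCommGroup in
/-- The corresponding normed space structure on `Λ_N`. -/
abbrev Gr.normedSpace (N : ℕ) : NormedSpace ℝ (Gr N) :=
  NormedSpace.induced ℝ (Gr N) (Finset (Fin N) → ℝ) (Gr.monomialBasis N).equivFun.toLinearMap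

/-- The objects of the category of finite-dimensional Grassmann algebras: the algebras `Λ_N`. -/
structure GrassmannAlg where
  /-- the number of odd generators -/
  gens : ℕ

/-- Morphisms of Grassmann algebras are the (unital, parity preserving, real) superalgebra
morphisms. -/
instance : Category GrassmannAlg where
  Hom A B := GradedAlgHom ℝ (Gr.parity A.gens) (Gr.parity B.gens)
  id A := GradedAlgHom.id ℝ (Gr.parity A.gens)
  comp f g := g.comp f

/-! ### The supermanifold `ℝ^{p|q}` -/

/-- The algebra of smooth real functions on an open subset of `ℝ^p`. -/
def SmoothFun (p : ℕ) (U : Opens (Fin p → ℝ)) : Type :=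
  C^∞⟮𝓘(ℝ, Fin p → ℝ), U; 𝓘(ℝ, ℝ), ℝ⟯

instance (p : ℕ) (U : Opens (Fin p → ℝ)) : CommRing (SmoothFun p U) :=
  inferInstanceAs (CommRing C^∞⟮𝓘(ℝ, Fin p → ℝ), U; 𝓘(ℝ, ℝ), ℝ⟯)

instance (p : ℕ) (U : Opens (Fin p → ℝ)) : Algebra ℝ (SmoothFun p U) :=
  inferInstanceAs (Algebra ℝ C^∞⟮𝓘(ℝ, Fin p → ℝ), U; 𝓘(ℝ, ℝ), ℝ⟯)

/-- The superalgebra `C^∞(U) ⊗ Λ(θ_1, …, θ_q)` of sections over `U ⊆ ℝ^p` of the structure sheaf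
of `ℝ^{p|q}`. -/
abbrev Sections (p q : ℕ) (U : Opens (Fin p → ℝ)) : Type :=
  SmoothFun p U ⊗[ℝ] Gr q

/-- The `ℤ/2`-grading of `C^∞(U) ⊗ Λ(θ_1, …, θ_q)`: the part of parity `i` is
`C^∞(U) ⊗ Λ(θ_1, …, θ_q)_i`. -/
abbrev Sections.parity (p q : ℕ) (U : Opens (Fin p → ℝ)) :
    ZMod 2 → Submodule ℝ (Sections p q U) :=
  fun i => ((Gr.parity q i).baseChange (SmoothFun p U)).restrictScalars ℝ

/-- Restriction of smooth functions. -/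
def SmoothFun.restrict {p : ℕ} {U V : Opens (Fin p → ℝ)} (h : U ≤ V) :
    SmoothFun p V →ₐ[ℝ] SmoothFun p U :=
  { ContMDiffMap.restrictRingHom 𝓘(ℝ, Fin p → ℝ) 𝓘(ℝ, ℝ) ℝ h with
    commutes' := fun _ => rfl }

/-- Evaluation of smooth functions at a point. -/
def SmoothFun.eval {p : ℕ} {U : Opens (Fin p → ℝ)} (x : U) : SmoothFun p U →ₐ[ℝ] ℝ :=
  { ContMDiffMap.evalRingHom x with
    commutes' := fun _ => rfl }

/-- The restriction maps of the structure sheaf of `ℝ^{p|q}`. -/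
def Sections.restrict (p q : ℕ) {U V : Opens (Fin p → ℝ)} (h : U ≤ V) :
    GradedAlgHom ℝ (Sections.parity p q V) (Sections.parity p q U) :=
  { Algebra.TensorProduct.map (SmoothFun.restrict h) (AlgHom.id ℝ (Gr q)) with
    map_mem := by
      intro i x hx
      change x ∈ (Gr.parity q i).baseChange (SmoothFun p V) at hx
      change Algebra.TensorProduct.map (SmoothFun.restrict h) (AlgHom.id ℝ (Gr q)) x ∈
        (Gr.parity q i).baseChange (SmoothFun p U)
      rw [Submodule.baseChange_eq_span] at hx
      induction hx using Submodule.span_induction with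
      | mem y hy =>
        obtain ⟨a, ha, rfl⟩ := hy
        simpa using Submodule.tmul_mem_baseChange_of_mem (1 : SmoothFun p U) ha
      | zero => simp
      | add y z _ _ hy hz => rw [map_add]; exact add_mem hy hz
      | smul c y _ hy =>
        rw [Algebra.smul_def, map_mul]
        have : Algebra.TensorProduct.map (SmoothFun.restrict h) (AlgHom.id ℝ (Gr q))
            (algebraMap (SmoothFun p V) (Sections p q V) c) =
            algebraMap (SmoothFun p U) (Sections p q U) (SmoothFun.restrict h c) := by
          simp [Algebra.TensorProduct.algebraMap_apply]
        rw [this, ← Algebra.smul_def]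
        exact Submodule.smul_mem _ _ hy }

/-- The value at `x ∈ U` of a section `s` over `U`, i.e. the value at `x` of the smooth function
underlying `s`. -/
def Sections.value (p q : ℕ) {U : Opens (Fin p → ℝ)} (x : U) : Sections p q U →ₐ[ℝ] ℝ :=
  Algebra.TensorProduct.lift (SmoothFun.eval x) Gr.body (fun _ _ => Commute.all _ _)

/-- The `i`-th coordinate function on `ℝ^p`. -/
def SmoothFun.coord {p : ℕ} (i : Fin p) : SmoothFun p ⊤ :=
  (⟨fun x => x.1 i, ((contDiff_apply ℝ ℝ i).contMDiff).comp contMDiff_subtype_val⟩ :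
    C^∞⟮𝓘(ℝ, Fin p → ℝ), (⊤ : Opens (Fin p → ℝ)); 𝓘(ℝ, ℝ), ℝ⟯)

/-- The even coordinate `x_i` of `ℝ^{p|q}`. -/
def evenCoord (p q : ℕ) (i : Fin p) : Sections p q ⊤ :=
  SmoothFun.coord i ⊗ₜ[ℝ] (1 : Gr q)

/-- The odd coordinate `θ_j` of `ℝ^{p|q}`. -/
def oddCoord (p q : ℕ) (j : Fin q) : Sections p q ⊤ :=
  (1 : SmoothFun p ⊤) ⊗ₜ[ℝ] (Gr.gen j : Gr q)

/-- A morphism of supermanifolds `ℝ^{p|q} → ℝ^{m|n}`: a morphism of superspaces, that is, a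
continuous map together with a morphism of sheaves of superalgebras (the pullback) that is local on
the stalks. The maximal ideal of the stalk of `ℝ^{p|q}` at `x` consists of the germs at `x` whose
value at `x` is zero. -/
structure Morphism (p q m n : ℕ) where
  /-- the underlying continuous map -/
  base : C(Fin p → ℝ, Fin m → ℝ)
  /-- the pullback of sections -/
  pullback (V : Opens (Fin m → ℝ)) :
    GradedAlgHom ℝ (Sections.parity m n V) (Sections.parity p q (Opens.comap base V))
  /-- the pullback commutes with restrictions -/
  pullback_restrict {W V : Opens (Fin m → ℝ)} (h : W ≤ V) (s : Sections m n V) :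
    pullback W (Sections.restrict m n h s) =
      Sections.restrict p q (Opens.comap_mono base h) (pullback V s)
  /-- the pullback maps the maximal ideal of the stalk at `base x` into that of the stalk at `x` -/
  pullback_local {V : Opens (Fin m → ℝ)} (x : Opens.comap base V) (s : Sections m n V) :
    Sections.value m n (⟨base x.1, x.2⟩ : V) s = 0 → Sections.value p q x (pullback V s) = 0

/-- The pullback `φ^* : O(ℝ^{m|n}) → O(ℝ^{p|q})` of global sections. -/
def Morphism.globalPullback {p q m n : ℕ} (φ : Morphism p q m n) :
    GradedAlgHom ℝ (Sections.parity m n ⊤) (Sections.parity p q ⊤) :=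
  (Sections.restrict p q (map_top (Opens.comap φ.base)).ge).comp
    (φ.pullback ⊤)

/-! ### `Λ`-points -/

/-- The functor `Λ ↦ ℝ^{p|q}_Λ = Hom_SAlg(O(ℝ^{p|q}), Λ)` from finite-dimensional Grassmann algebras
to sets. -/
def points (p q : ℕ) : GrassmannAlg ⥤ Type where
  obj A := GradedAlgHom ℝ (Sections.parity p q ⊤) (Gr.parity A.gens)
  map {A B} ρ := ↾(fun (x : GradedAlgHom ℝ (Sections.parity p q ⊤) (Gr.parity A.gens)) =>
    (GradedAlgHom.comp (show GradedAlgHom ℝ (Gr.parity A.gens) (Gr.parity B.gens) from ρ) x))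

/-- The superalgebra morphism `O(ℝ^{p|q}) → Λ` that a `Λ`-point is. -/
def points.hom {p q : ℕ} {A : GrassmannAlg} (x : (points p q).obj A) :
    GradedAlgHom ℝ (Sections.parity p q ⊤) (Gr.parity A.gens) := x

/-- The natural transformation `x ↦ x ∘ φ^*` given by a supermanifold morphism `φ`. -/
def Morphism.toNatTrans {p q m n : ℕ} (φ : Morphism p q m n) : points p q ⟶ points m n where
  app _ := ↾(fun x => (points.hom x).comp φ.globalPullback)

/-- The space `Λ_0^p × Λ_1^q` of coordinates of `Λ_N`-points of `ℝ^{p|q}`. -/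
abbrev CoordSpace (p q N : ℕ) : Type := (Fin p → Gr.parity N 0) × (Fin q → Gr.parity N 1)

lemma evenCoord_mem (p q : ℕ) (i : Fin p) : evenCoord p q i ∈ Sections.parity p q ⊤ 0 :=
  Submodule.tmul_mem_baseChange_of_mem _ (SetLike.GradedOne.one_mem (A := Gr.parity q))

lemma oddCoord_mem (p q : ℕ) (j : Fin q) : oddCoord p q j ∈ Sections.parity p q ⊤ 1 :=
  Submodule.tmul_mem_baseChange_of_mem _ (CliffordAlgebra.ι_mem_evenOdd_one _ _)

/-- The coordinates of a `Λ`-point of `ℝ^{p|q}`, i.e. the images of the even coordinates `x_i` in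
`Λ_0` and of the odd coordinates `θ_j` in `Λ_1`. -/
def coords {p q : ℕ} {A : GrassmannAlg} (x : (points p q).obj A) : CoordSpace p q A.gens :=
  (fun i => ⟨points.hom x (evenCoord p q i), (points.hom x).map_mem (evenCoord_mem p q i)⟩,
   fun j => ⟨points.hom x (oddCoord p q j), (points.hom x).map_mem (oddCoord_mem p q j)⟩)

/-- The action of `Λ_0` on `Λ_0^p × Λ_1^q` by multiplication. -/
def CoordSpace.evenSMul {p q N : ℕ} (c : Gr.parity N 0) (v : CoordSpace p q N) :
    CoordSpace p q N :=
  (fun i => ⟨c.1 * (v.1 i).1, by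
      simpa using SetLike.GradedMul.mul_mem (A := Gr.parity N) c.2 (v.1 i).2⟩,
   fun j => ⟨c.1 * (v.2 j).1, by
      simpa using SetLike.GradedMul.mul_mem (A := Gr.parity N) c.2 (v.2 j).2⟩)

attribute [local instance] Gr.normedAddCommGroup Gr.normedSpace in
/-- A map `ℝ^{p|q}_Λ → ℝ^{m|n}_Λ` is `Λ_0`-smooth if, read in the coordinates
`ℝ^{p|q}_Λ ≅ Λ_0^p × Λ_1^q` and `ℝ^{m|n}_Λ ≅ Λ_0^m × Λ_1^n`, it is a smooth map between
finite-dimensional real vector spaces whose differential is `Λ_0`-linear at each point. -/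
def IsEvenSmooth {p q m n : ℕ} {A : GrassmannAlg}
    (a : (points p q).obj A → (points m n).obj A) : Prop :=
  ∃ f : CoordSpace p q A.gens → CoordSpace m n A.gens,
    (∀ x, coords (a x) = f (coords x)) ∧ ContDiff ℝ ∞ f ∧
    ∀ (u v : CoordSpace p q A.gens) (c : Gr.parity A.gens 0),
      fderiv ℝ f u (CoordSpace.evenSMul c v) = CoordSpace.evenSMul c (fderiv ℝ f u v)

/-! ### Formal series -/

/-- Formal series `∑ f_{ν,J} X^ν Θ^J` in `p` even variables `X_1, …, X_p` and `q` odd variables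
`Θ_1, …, Θ_q`, whose coefficients `f_{ν,J}` are arbitrary functions on `ℝ^p`, given by the family of
their coefficients. -/
abbrev FormalSeries (p q : ℕ) : Type :=
  (Fin p → ℕ) → Finset (Fin q) → (Fin p → ℝ) → ℝ

/-- The formal series of parity `i`: only terms with `|J| ≡ i` modulo 2 occur. -/
def FormalSeries.parity (p q : ℕ) (i : ZMod 2) : Submodule ℝ (FormalSeries p q) where
  carrier := {F | ∀ ν J, (J.card : ZMod 2) ≠ i → F ν J = 0}
  add_mem' hF hG ν J h := by simp [hF ν J h, hG ν J h]
  zero_mem' _ _ _ := rfl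
  smul_mem' c F hF ν J h := by simp [hF ν J h]

/-- The element `∑_{ν,J} f_{ν,J}(x̃) x°^ν θ^J` of `Λ_N` for even elements `x_i` with bodies `x̃_i`
and nilpotent parts `x°_i` and odd elements `θ_j`. Only finitely many terms are nonzero. The
factors of `x°^ν` commute; those of `θ^J` are taken in increasing order. -/
def FormalSeries.evalAt {p q N : ℕ} (F : FormalSeries p q) (u : CoordSpace p q N) : Gr N :=
  ∑ᶠ ν : Fin p → ℕ, ∑ J : Finset (Fin q),
    F ν J (fun i => Gr.body (u.1 i).1) •
      ((List.ofFn fun i => Gr.nil (u.1 i).1 ^ ν i).prod *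
        ((J.sort (· ≤ ·)).map fun j => (u.2 j).1).prod)

end Super

end

noncomputable section

namespace Super

/-! ### Supercommutative algebras -/

/-! Coordinates identify the Λ-points of ℝ^{p|q} with Λ_0^p × Λ_1^q, compatibly with morphisms of Λ.
A natural transformation is therefore a tuple of natural functions g : Λ_0^p × Λ_1^q → Λ (`NatFun`)
with values of the right parity.

Part 1. Adjoin two odd generators η₁, η₂ to Λ and look at g(u + η₁η₂ e_i). The substitution η₁ ↦
2η₁, η₂ ↦ η₂/2 fixes the argument, hence by naturality the value, so the value has the form g(u) +
η₁η₂ · (∂_i g)(u). Substituting odd elements b, c for η₁, η₂ gives g(u + bc e_i) = g(u) + bc · (∂_i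
g)(u), and ∂_i g is again natural (`NatFun.exists_isDeriv`). The ∂_i commute (`NatFun.deriv_comm`).
Every nilpotent even element is a sum of products bc, so g is determined by its iterated derivatives
at points with real even coordinates a, and by naturality already at the generic point (a, θ_1, …,
θ_q) over Λ_q (`NatFun.eq_zero_of_iterDeriv`). On a formal series ∂_i acts as the formal derivative
(`FormalSeries.isDeriv_toNatFun`), so the θ^J-coefficient of ∂^ν g / ν! at (a, θ) is f_{ν,J}(a).
These numbers are subject to no condition, since a morphism of Grassmann algebras preserves bodies.
This is `FormalSeries.toNatFun_bijective`.

Part 2, from morphisms to smoothness. The value of f ∈ C^∞(ℝ^p) at an even point is built from the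
value at the body by successive shifts E ↦ E + w · E ∘ ∂_i with w central and w² = 0. This is
Taylor's formula one monomial at a time, and it gives the differential v ↦ ∑ v_i · (∂_i f)(u), which
is Λ_0-linear (`evalList_smooth`).

Part 2, converse. Λ_0-linearity gives dg(η₁η₂ e_i) = η₁η₂ · dg(e_i), so the algebraic ∂_i g is the
real partial derivative (`NatFun.hasRealDerivs_of_evenSmooth`). Hence a smooth natural g is
determined by its values at the generic points (`NatFun.eq_zero_of_evenSmooth`). These values are
smooth functions ℝ^p → Λ_q, that is, sections; the morphism with these sections as coordinates
(`MorphismData.toMorphism`) induces a transformation that agrees with the given one at the generic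
points, hence everywhere. -/

/-- A `ℤ/2`-graded algebra is supercommutative if its even elements are central and its odd
elements have square zero. -/
structure SuperComm {R : Type*} [Ring R] [Algebra ℝ R] (𝒜 : ZMod 2 → Submodule ℝ R) : Prop where
  comm : ∀ {a}, a ∈ 𝒜 0 → ∀ b, Commute a b
  sq : ∀ {a}, a ∈ 𝒜 1 → a * a = 0

section

variable {R : Type*} [Ring R] [Algebra ℝ R] {𝒜 : ZMod 2 → Submodule ℝ R}

lemma SuperComm.anticomm (h : SuperComm 𝒜) {a b : R} (ha : a ∈ 𝒜 1) (hb : b ∈ 𝒜 1) :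
    a * b = -(b * a) := by
  have := h.sq (add_mem ha hb)
  rw [add_mul, mul_add, mul_add, h.sq ha, h.sq hb, zero_add, add_zero] at this
  exact eq_neg_of_add_eq_zero_left this

lemma SuperComm.odd_mul_odd_sq (h : SuperComm 𝒜) {a b : R} (ha : a ∈ 𝒜 1) (hb : b ∈ 𝒜 1) :
    a * b * (a * b) = 0 := by
  rw [mul_assoc, ← mul_assoc b, h.anticomm hb ha, neg_mul, mul_assoc a b b, h.sq hb]
  simp

end

section

variable {R : Type*} [Ring R] [Algebra ℝ R] {𝒜 : ZMod 2 → Submodule ℝ R} [GradedAlgebra 𝒜]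

lemma even_mul_mem {a b : R} {i : ZMod 2} (ha : a ∈ 𝒜 0) (hb : b ∈ 𝒜 i) : a * b ∈ 𝒜 i := by
  simpa using SetLike.mul_mem_graded ha hb

lemma odd_mul_odd_mem {a b : R} (ha : a ∈ 𝒜 1) (hb : b ∈ 𝒜 1) : a * b ∈ 𝒜 0 :=
  SetLike.mul_mem_graded ha hb

lemma one_mem_even : (1 : R) ∈ 𝒜 0 := SetLike.one_mem_graded 𝒜

lemma algebraMap_mem_even (r : ℝ) : algebraMap ℝ R r ∈ 𝒜 0 := SetLike.algebraMap_mem_graded 𝒜 r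

end

/-! ### The Grassmann algebras are supercommutative -/

namespace Gr

variable {N : ℕ}

lemma anticomm_ι_of_odd (v : Fin N → ℝ) {a : Gr N} (ha : a ∈ parity N 1) :
    a * ExteriorAlgebra.ι ℝ v = -(ExteriorAlgebra.ι ℝ v * a) := by
  induction a, ha using CliffordAlgebra.odd_induction with
  | ι w => exact eq_neg_of_add_eq_zero_left (ExteriorAlgebra.ι_add_mul_swap w v)
  | add x y _ _ hx hy => rw [add_mul, hx, hy, mul_add, neg_add]
  | ι_mul_ι_mul m₁ m₂ x _ hx =>
    have h := fun w => eq_neg_of_add_eq_zero_left (ExteriorAlgebra.ι_add_mul_swap (R := ℝ) w v)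
    change ExteriorAlgebra.ι ℝ m₁ * ExteriorAlgebra.ι ℝ m₂ * x * ExteriorAlgebra.ι ℝ v =
      -(ExteriorAlgebra.ι ℝ v * (ExteriorAlgebra.ι ℝ m₁ * ExteriorAlgebra.ι ℝ m₂ * x))
    rw [mul_assoc, hx, mul_neg, ← mul_assoc, mul_assoc (ExteriorAlgebra.ι ℝ m₁), h, mul_neg,
      ← mul_assoc, h]
    simp [mul_assoc]

lemma commute_of_even {a : Gr N} (ha : a ∈ parity N 0) (b : Gr N) : Commute a b := by
  have key : ∀ v : Fin N → ℝ, Commute a (ExteriorAlgebra.ι ℝ v) := by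
    intro v
    induction a, ha using CliffordAlgebra.even_induction with
    | algebraMap r => exact Algebra.commutes r _
    | add x y _ _ hx hy => exact hx.add_left hy
    | ι_mul_ι_mul m₁ m₂ x _ hx =>
      refine Commute.mul_left ?_ hx
      have h := fun w => eq_neg_of_add_eq_zero_left (ExteriorAlgebra.ι_add_mul_swap (R := ℝ) w v)
      change ExteriorAlgebra.ι ℝ m₁ * ExteriorAlgebra.ι ℝ m₂ * ExteriorAlgebra.ι ℝ v =
        ExteriorAlgebra.ι ℝ v * (ExteriorAlgebra.ι ℝ m₁ * ExteriorAlgebra.ι ℝ m₂)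
      rw [mul_assoc, h, mul_neg, ← mul_assoc, h]
      simp [mul_assoc]
  induction b using ExteriorAlgebra.induction with
  | algebraMap r => exact (Algebra.commutes r a).symm
  | ι v => exact key v
  | mul x y hx hy => exact hx.mul_right hy
  | add x y hx hy => exact hx.add_right hy

lemma sq_of_odd {a : Gr N} (ha : a ∈ parity N 1) : a * a = 0 := by
  have key : ∀ b ∈ parity N 1, a * b = -(b * a) := by
    intro b hb
    induction b, hb using CliffordAlgebra.odd_induction with
    | ι w => exact anticomm_ι_of_odd w ha
    | add x y _ _ hx hy => rw [mul_add, hx, hy, add_mul, neg_add]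
    | ι_mul_ι_mul m₁ m₂ x _ hx =>
      rw [← mul_assoc,
        ← ((commute_of_even (CliffordAlgebra.ι_mul_ι_mem_evenOdd_zero _ m₁ m₂) a).eq),
        mul_assoc, mul_assoc, mul_assoc, hx]
      simp [mul_assoc]
  have h2 : (2 : ℝ) • (a * a) = 0 := by
    rw [two_smul]; exact add_eq_zero_iff_eq_neg.mpr (key a ha)
  exact (smul_eq_zero.mp h2).resolve_left two_ne_zero

lemma superComm (N : ℕ) : SuperComm (parity N) := ⟨commute_of_even, sq_of_odd⟩

lemma gen_mem (i : Fin N) : (gen i : Gr N) ∈ parity N 1 := CliffordAlgebra.ι_mem_evenOdd_one _ _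

lemma algHom_ext {R : Type*} [Ring R] [Algebra ℝ R] {f g : Gr N →ₐ[ℝ] R}
    (h : ∀ i, f (gen i) = g (gen i)) : f = g := by
  refine ExteriorAlgebra.hom_ext (LinearMap.pi_ext' fun i => LinearMap.ext_ring ?_)
  exact h i

lemma ι_eq_sum (v : Fin N → ℝ) : ExteriorAlgebra.ι ℝ v = ∑ i, v i • (gen i : Gr N) := by
  simp only [gen, ← map_smul, ← map_sum]
  congr 1
  ext j
  simp [Finset.sum_apply, Pi.single_apply]

variable {R : Type*} [Ring R] [Algebra ℝ R] {𝒜 : ZMod 2 → Submodule ℝ R} [GradedAlgebra 𝒜]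

/-- The morphism from the Grassmann algebra given by odd elements of a supercommutative algebra. -/
def lift (h𝒜 : SuperComm 𝒜) (b : Fin N → 𝒜 1) : GradedAlgHom ℝ (parity N) 𝒜 :=
  { ExteriorAlgebra.lift ℝ ⟨(𝒜 1).subtype ∘ₗ Fintype.linearCombination ℝ b,
      fun _ => h𝒜.sq (Subtype.prop _)⟩ with
    map_mem := by
      intro i x hx
      set L := ExteriorAlgebra.lift ℝ ⟨(𝒜 1).subtype ∘ₗ Fintype.linearCombination ℝ b,
        fun _ => h𝒜.sq (Subtype.prop _)⟩ with hL
      change L x ∈ 𝒜 i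
      have hι : ∀ v, L (CliffordAlgebra.ι _ v) ∈ 𝒜 1 := fun v => by
        have : L (CliffordAlgebra.ι _ v) = _ := ExteriorAlgebra.lift_ι_apply ℝ _ _ v
        rw [this]
        exact Subtype.prop _
      have hcases : ∀ i : ZMod 2, i = 0 ∨ i = 1 := by decide
      rcases hcases i with rfl | rfl
      · induction x, hx using CliffordAlgebra.even_induction with
        | algebraMap r => rw [AlgHom.commutes]; exact algebraMap_mem_even r
        | add x y _ _ hx hy => rw [map_add]; exact add_mem hx hy
        | ι_mul_ι_mul m₁ m₂ x _ hx =>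
          rw [map_mul, map_mul]; exact even_mul_mem (odd_mul_odd_mem (hι _) (hι _)) hx
      · induction x, hx using CliffordAlgebra.odd_induction with
        | ι v => exact hι v
        | add x y _ _ hx hy => rw [map_add]; exact add_mem hx hy
        | ι_mul_ι_mul m₁ m₂ x _ hx =>
          rw [map_mul, map_mul]; exact even_mul_mem (odd_mul_odd_mem (hι _) (hι _)) hx }

lemma lift_gen (h𝒜 : SuperComm 𝒜) (b : Fin N → 𝒜 1) (i : Fin N) :
    lift h𝒜 b (gen i) = (b i : R) := by
  refine (ExteriorAlgebra.lift_ι_apply ℝ _ _ _).trans ?_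
  simp

lemma gradedAlgHom_ext {f g : GradedAlgHom ℝ (parity N) 𝒜}
    (h : ∀ i, f (gen i) = g (gen i)) : f = g :=
  GradedAlgHom.coe_toAlgHom_injective (algHom_ext h)

/-! ### The body -/

@[simp] lemma body_gen (i : Fin N) : body (gen i : Gr N) = 0 := by
  simp [body, gen, ExteriorAlgebra.algebraMapInv]

lemma body_ι (v : Fin N → ℝ) : body (ExteriorAlgebra.ι ℝ v) = 0 := by
  simp [body, ExteriorAlgebra.algebraMapInv]

lemma body_of_odd {a : Gr N} (ha : a ∈ parity N 1) : body a = 0 := by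
  have := congrArg body (sq_of_odd ha)
  simpa using this

/-- Generators go to odd elements, which have no body. This is why coefficient functions of the body
may be arbitrary: naturality does not constrain them. -/
lemma body_map {N' : ℕ} (ρ : GradedAlgHom ℝ (parity N) (parity N')) (a : Gr N) :
    body (ρ a) = body a := by
  have : body.comp ρ.toAlgHom = (body : Gr N →ₐ[ℝ] ℝ) := by
    refine algHom_ext fun i => ?_
    rw [body_gen]
    exact body_of_odd (ρ.map_mem (gen_mem i))
  exact DFunLike.congr_fun this a

lemma nil_map {N' : ℕ} (ρ : GradedAlgHom ℝ (parity N) (parity N')) (a : Gr N) :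
    nil (ρ a) = ρ (nil a) := by
  rw [nil, nil, body_map, map_sub, GradedAlgHom.commutes]

@[simp] lemma body_nil (a : Gr N) : body (nil a) = 0 := by simp [nil]

lemma body_add_nil (a : Gr N) : algebraMap ℝ (Gr N) (body a) + nil a = a := by simp [nil]

lemma nil_mem_even {a : Gr N} (ha : a ∈ parity N 0) : nil a ∈ parity N 0 :=
  sub_mem ha (algebraMap_mem_even _)

/-- The augmentation ideal of the Grassmann algebra. -/
def aug (N : ℕ) : Submodule ℝ (Gr N) := LinearMap.ker (body (N := N)).toLinearMap

lemma mem_aug {a : Gr N} : a ∈ aug N ↔ body a = 0 := Iff.rfl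

lemma aug_eq : aug N = LinearMap.range (ExteriorAlgebra.ι ℝ (M := Fin N → ℝ)) * ⊤ := by
  apply le_antisymm
  · have key : ∀ a : Gr N, a - algebraMap ℝ _ (body a) ∈
        LinearMap.range (ExteriorAlgebra.ι ℝ (M := Fin N → ℝ)) * ⊤ := by
      intro a
      induction a using CliffordAlgebra.left_induction with
      | algebraMap r => simp
      | add x y hx hy =>
        convert add_mem hx hy using 1
        simp only [map_add]; abel
      | ι_mul x m _ =>
        have : body (CliffordAlgebra.ι 0 m * x) = 0 := by
          rw [map_mul, show CliffordAlgebra.ι 0 m = ExteriorAlgebra.ι ℝ m from rfl, body_ι,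
            zero_mul]
        rw [this, map_zero, sub_zero]
        exact Submodule.mul_mem_mul ⟨m, rfl⟩ trivial
    intro a ha
    simpa [mem_aug.mp ha] using key a
  · rw [Submodule.mul_le]
    rintro _ ⟨v, rfl⟩ b -
    rw [mem_aug, map_mul, body_ι, zero_mul]

lemma top_mul_aug : ⊤ * aug N ≤ aug N := by
  rw [Submodule.mul_le]
  intro a _ b hb
  rw [mem_aug, map_mul, mem_aug.mp hb, mul_zero]

lemma aug_pow_le (k : ℕ) :
    aug N ^ k ≤ LinearMap.range (ExteriorAlgebra.ι ℝ (M := Fin N → ℝ)) ^ k * ⊤ := by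
  induction k with
  | zero => simp [pow_zero]
  | succ k ih =>
    calc aug N ^ (k + 1) = aug N ^ k * aug N := pow_succ _ _
      _ ≤ LinearMap.range (ExteriorAlgebra.ι ℝ) ^ k * ⊤ * aug N := by gcongr
      _ ≤ LinearMap.range (ExteriorAlgebra.ι ℝ) ^ k * aug N := by
          rw [mul_assoc]; gcongr; exact top_mul_aug
      _ = _ := by rw [aug_eq, pow_succ, mul_assoc]

/-- The power of the space of generators is the exterior power of degree N + 1 of an N-dimensional
space, whose dimension is `N.choose (N + 1) = 0`. -/
lemma aug_pow_eq_bot : aug N ^ (N + 1) = ⊥ := by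
  rw [eq_bot_iff]
  refine (aug_pow_le _).trans ?_
  have : LinearMap.range (ExteriorAlgebra.ι ℝ (M := Fin N → ℝ)) ^ (N + 1) = ⊥ := by
    have h := exteriorPower.finrank_eq (R := ℝ) (M := Fin N → ℝ) (N + 1)
    rw [Module.finrank_fin_fun, Nat.choose_succ_self] at h
    exact Submodule.finrank_eq_zero.mp h
  rw [this, Submodule.bot_mul]

lemma pow_eq_zero_of_body_eq_zero {a : Gr N} (h : body a = 0) {k : ℕ} (hk : N < k) : a ^ k = 0 := by
  have : a ^ (N + 1) = 0 := by
    have := Submodule.pow_mem_pow (aug N) (mem_aug.mpr h) (N + 1)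
    rwa [aug_pow_eq_bot, Submodule.mem_bot] at this
  exact pow_eq_zero_of_le hk this

/-! ### Monomials -/

lemma monomialBasis_apply (S : Finset (Fin N)) :
    monomialBasis N S = ((S.sort (· ≤ ·)).map gen).prod := by
  rw [monomialBasis, ExteriorAlgebra.basis_apply]
  change ExteriorAlgebra.ιMulti ℝ S.card (_ ∘ S.orderEmbOfFin rfl) = _
  rw [ExteriorAlgebra.ιMulti_apply, List.ofFn_eq_map, ← Finset.listMap_orderEmbOfFin_finRange S rfl,
    List.map_map]
  simp only [Function.comp_def, Pi.basisFun_apply]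
  rfl

@[simp] lemma monomialBasis_empty : monomialBasis N ∅ = 1 := by
  rw [monomialBasis_apply]; simp

lemma monomialBasis_mul_self {S : Finset (Fin N)} (hS : S.Nonempty) :
    monomialBasis N S * monomialBasis N S = 0 :=
  ExteriorAlgebra.basis_mul_of_not_disjoint _ (Set.powersetCard.ofCard (s := S) rfl)
    (Set.powersetCard.ofCard (s := S) rfl)
    (fun h => hS.ne_empty (Finset.disjoint_self_iff_empty _ |>.mp h))

lemma list_prod_mem {R : Type*} [Ring R] [Algebra ℝ R] {𝒜 : ZMod 2 → Submodule ℝ R}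
    [GradedAlgebra 𝒜] (l : List R) (hl : ∀ a ∈ l, a ∈ 𝒜 1) : l.prod ∈ 𝒜 (l.length : ZMod 2) := by
  induction l with
  | nil => simpa using one_mem_even
  | cons a l ih =>
    rw [List.prod_cons, List.length_cons, Nat.cast_succ, add_comm]
    exact SetLike.mul_mem_graded (hl a (by simp)) (ih fun b hb => hl b (by simp [hb]))

lemma monomialBasis_mem (S : Finset (Fin N)) :
    monomialBasis N S ∈ parity N (S.card : ZMod 2) := by
  rw [monomialBasis_apply]
  have := list_prod_mem (𝒜 := parity N) ((S.sort (· ≤ ·)).map gen) (by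
    simp only [List.mem_map]; rintro _ ⟨i, -, rfl⟩; exact gen_mem i)
  simpa using this

lemma body_monomialBasis {S : Finset (Fin N)} (hS : S.Nonempty) : body (monomialBasis N S) = 0 := by
  have := congrArg body (monomialBasis_mul_self hS)
  simpa using this

lemma body_eq_repr (a : Gr N) : body a = (monomialBasis N).repr a ∅ := by
  conv_lhs => rw [← (monomialBasis N).sum_repr a]
  rw [map_sum, Finset.sum_eq_single ∅]
  · simp
  · intro S _ hS
    rw [map_smul, body_monomialBasis (Finset.nonempty_iff_ne_empty.mpr hS), smul_zero]
  · simp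

/-- Monomials are homogeneous, so the terms of the wrong parity add up to an element that lies in
both complementary parts and is therefore zero. -/
lemma sum_repr_of_mem {i : ZMod 2} {a : Gr N} (ha : a ∈ parity N i) :
    ∑ S with (S.card : ZMod 2) = i, (monomialBasis N).repr a S • monomialBasis N S = a := by
  have h := (monomialBasis N).sum_repr a
  rw [← Finset.sum_filter_add_sum_filter_not _ (fun S => (S.card : ZMod 2) = i)] at h
  set x := ∑ S with (S.card : ZMod 2) = i, (monomialBasis N).repr a S • monomialBasis N S
  set y := ∑ S with ¬ (S.card : ZMod 2) = i, (monomialBasis N).repr a S • monomialBasis N S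
  have hx : x ∈ parity N i := by
    refine sum_mem fun S hS => Submodule.smul_mem _ _ ?_
    rw [← (Finset.mem_filter.mp hS).2]; exact monomialBasis_mem S
  have hcases : ∀ i j : ZMod 2, ¬ j = i → j = i + 1 := by decide
  have hy : y ∈ parity N (i + 1) := by
    refine sum_mem fun S hS => Submodule.smul_mem _ _ ?_
    rw [← hcases i _ (Finset.mem_filter.mp hS).2]; exact monomialBasis_mem S
  have hy' : y ∈ parity N i := by
    rw [← h] at ha; simpa using sub_mem ha hx
  have hcases : ∀ i : ZMod 2, i = 0 ∨ i = 1 := by decide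
  have hd : Disjoint (parity N i) (parity N (i + 1)) := by
    have := (CliffordAlgebra.evenOdd_isCompl (0 : QuadraticForm ℝ (Fin N → ℝ))).disjoint
    rcases hcases i with rfl | rfl
    · exact this
    · exact this.symm
  have : y = 0 := Submodule.disjoint_def.mp hd y hy' hy
  rw [← h, this, add_zero]

lemma repr_eq_zero_of_mem {i : ZMod 2} {a : Gr N} (ha : a ∈ parity N i) {S : Finset (Fin N)}
    (hS : (S.card : ZMod 2) ≠ i) : (monomialBasis N).repr a S = 0 := by
  rw [← sum_repr_of_mem ha, map_sum, Finsupp.finsetSum_apply]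
  refine Finset.sum_eq_zero fun T hT => ?_
  have : T ≠ S := fun h => hS (h ▸ (Finset.mem_filter.mp hT).2)
  simp [this]

/-- An even element without body is a sum of products of two odd elements. -/
lemma nil_mem_span {a : Gr N} (ha : a ∈ parity N 0) :
    nil a ∈ Submodule.span ℝ {w | ∃ b ∈ parity N 1, ∃ c ∈ parity N 1, b * c = w} := by
  induction a, ha using CliffordAlgebra.even_induction with
  | algebraMap r => simp [nil]
  | add x y _ _ hx hy =>
    convert add_mem hx hy using 1
    simp only [nil, map_add]; abel
  | ι_mul_ι_mul m₁ m₂ x hx _ =>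
    refine Submodule.subset_span ⟨CliffordAlgebra.ι _ m₁, CliffordAlgebra.ι_mem_evenOdd_one _ _,
      x * CliffordAlgebra.ι _ m₂,
      even_mul_mem (𝒜 := parity N) hx (CliffordAlgebra.ι_mem_evenOdd_one _ _), ?_⟩
    have h0 : body (CliffordAlgebra.ι (0 : QuadraticForm ℝ (Fin N → ℝ)) m₁ *
        CliffordAlgebra.ι _ m₂ * x) = 0 := by
      rw [map_mul, map_mul, body_of_odd (CliffordAlgebra.ι_mem_evenOdd_one _ _)]; simp
    rw [nil, h0, map_zero, sub_zero, (commute_of_even hx _).eq, mul_assoc]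

end Gr
end Super

namespace Super

/-! ### Adjoining two odd generators to a Grassmann algebra -/

namespace Gr

variable {N N' : ℕ}

/-- The inclusion of `Λ_N` into `Λ_{N+2}`. -/
def incl (N : ℕ) : GradedAlgHom ℝ (parity N) (parity (N + 2)) :=
  lift (superComm _) fun i => ⟨gen (Fin.castAdd 2 i), gen_mem _⟩

/-- The first of the two new generators of `Λ_{N+2}`. -/
def eta₁ (N : ℕ) : parity (N + 2) 1 := ⟨gen (Fin.natAdd N 0), gen_mem _⟩

/-- The second of the two new generators of `Λ_{N+2}`. -/
def eta₂ (N : ℕ) : parity (N + 2) 1 := ⟨gen (Fin.natAdd N 1), gen_mem _⟩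

/-- The extension of a morphism on `Λ_N` to `Λ_{N+2}` with given values at the new generators. -/
def extend (ρ : GradedAlgHom ℝ (parity N) (parity N')) (b c : parity N' 1) :
    GradedAlgHom ℝ (parity (N + 2)) (parity N') :=
  lift (superComm _) (Fin.append (fun i => ⟨ρ (gen i), ρ.map_mem (gen_mem i)⟩) ![b, c])

@[simp] lemma incl_gen (i : Fin N) : incl N (gen i) = gen (Fin.castAdd 2 i) := lift_gen _ _ _

@[simp] lemma extend_eta₁ (ρ : GradedAlgHom ℝ (parity N) (parity N')) (b c : parity N' 1) :
    extend ρ b c (eta₁ N : Gr (N + 2)) = b := by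
  rw [extend, eta₁, lift_gen, Fin.append_right]; rfl

@[simp] lemma extend_eta₂ (ρ : GradedAlgHom ℝ (parity N) (parity N')) (b c : parity N' 1) :
    extend ρ b c (eta₂ N : Gr (N + 2)) = c := by
  rw [extend, eta₂, lift_gen, Fin.append_right]; rfl

lemma extend_comp_incl (ρ : GradedAlgHom ℝ (parity N) (parity N')) (b c : parity N' 1) :
    (extend ρ b c).comp (incl N) = ρ := by
  refine gradedAlgHom_ext fun i => ?_
  rw [GradedAlgHom.comp_apply, incl_gen, extend, lift_gen, Fin.append_left]

@[simp] lemma extend_incl (ρ : GradedAlgHom ℝ (parity N) (parity N')) (b c : parity N' 1)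
    (a : Gr N) : extend ρ b c (incl N a) = ρ a :=
  DFunLike.congr_fun (extend_comp_incl ρ b c) a

/-- The elements of this form contain the scalars and are stable under addition and under left
multiplication by each generator, old or new. -/
lemma exists_decomposition (z : Gr (N + 2)) : ∃ A B C D : Gr N, z = incl N A + eta₁ N * incl N B +
    eta₂ N * incl N C + eta₁ N * eta₂ N * incl N D := by
  have h11 : (eta₁ N * eta₁ N : Gr (N + 2)) = 0 := sq_of_odd (eta₁ N).2
  have h22 : (eta₂ N * eta₂ N : Gr (N + 2)) = 0 := sq_of_odd (eta₂ N).2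
  have h21 : (eta₂ N * eta₁ N : Gr (N + 2)) = -(eta₁ N * eta₂ N) :=
    (superComm _).anticomm (eta₂ N).2 (eta₁ N).2
  have hadd : ∀ x y : Gr (N + 2), (∃ A B C D : Gr N, x = incl N A + eta₁ N * incl N B +
      eta₂ N * incl N C + eta₁ N * eta₂ N * incl N D) → (∃ A B C D : Gr N, y = incl N A +
      eta₁ N * incl N B + eta₂ N * incl N C + eta₁ N * eta₂ N * incl N D) →
      ∃ A B C D : Gr N, x + y = incl N A +
      eta₁ N * incl N B + eta₂ N * incl N C + eta₁ N * eta₂ N * incl N D := by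
    rintro _ _ ⟨A, B, C, D, rfl⟩ ⟨A', B', C', D', rfl⟩
    refine ⟨A + A', B + B', C + C', D + D', ?_⟩
    simp only [map_add, mul_add]
    abel
  induction z using CliffordAlgebra.left_induction with
  | algebraMap r => exact ⟨algebraMap _ _ r, 0, 0, 0, by simp⟩
  | add x y hx hy => exact hadd x y hx hy
  | ι_mul x m hx =>
    change ∃ A B C D : Gr N, ExteriorAlgebra.ι ℝ m * x = _
    rw [ι_eq_sum, Fin.sum_univ_add, add_mul]
    obtain ⟨A, B, C, D, rfl⟩ := hx
    refine hadd _ _ ?_ ?_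
    · set v : Gr N := ∑ i, m (Fin.castAdd 2 i) • gen i with hv
      have hv' : ∑ i, m (Fin.castAdd 2 i) • (gen (Fin.castAdd 2 i) : Gr (N + 2)) = incl N v := by
        simp [hv, map_sum, map_smul]
      have hodd : v ∈ parity N 1 := sum_mem fun i _ => Submodule.smul_mem _ _ (gen_mem i)
      have hodd' := (incl N).map_mem hodd
      have h1 : incl N v * eta₁ N = -(eta₁ N * incl N v) := (superComm _).anticomm hodd' (eta₁ N).2
      have h2 : incl N v * eta₂ N = -(eta₂ N * incl N v) := (superComm _).anticomm hodd' (eta₂ N).2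
      rw [hv']
      refine ⟨v * A, -(v * B), -(v * C), v * D, ?_⟩
      simp only [map_mul, map_neg, mul_add, ← mul_assoc, h1, h2, neg_mul, mul_neg]
      rw [mul_assoc (eta₁ N : Gr (N + 2)) (incl N v) (eta₂ N : Gr (N + 2)), h2]
      simp only [mul_neg, neg_mul, neg_neg, mul_assoc]
    · rw [Fin.sum_univ_two]
      change ∃ A' B' C' D' : Gr N, (m (Fin.natAdd N 0) • (eta₁ N : Gr (N + 2)) +
        m (Fin.natAdd N 1) • (eta₂ N : Gr (N + 2))) * _ = _
      set s := m (Fin.natAdd N 0)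
      set t := m (Fin.natAdd N 1)
      -- Multiplying by sη₁ + tη₂ kills the terms with a repeated generator; the sign in front of t
      -- comes from η₂η₁ = −η₁η₂.
      refine ⟨0, s • A, t • A, s • C - t • B, ?_⟩
      simp only [add_mul, mul_add, smul_mul_assoc, map_smul, map_sub, mul_smul_comm, ← mul_assoc,
        h11, h22, h21, mul_sub, map_zero, zero_mul, smul_zero, neg_mul, smul_neg]
      rw [mul_assoc (eta₁ N : Gr (N + 2)) (eta₂ N : Gr (N + 2)) (eta₂ N : Gr (N + 2)), h22]
      simp only [mul_zero, zero_mul, smul_zero, neg_zero]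
      abel

/-- This allows η₁η₂ to be cancelled. Contraction with the dual vector of a generator e turns e y =
0 into y = e x; a morphism that kills e and fixes y then gives y = 0. This is done for η₁ and then
for η₂. -/
lemma eq_zero_of_eta_mul {D : Gr N} (h : (eta₁ N * eta₂ N * incl N D : Gr (N + 2)) = 0) :
    D = 0 := by
  have key : ∀ (j : Fin (N + 2)) (y : Gr (N + 2)), (gen j : Gr (N + 2)) * y = 0 →
      ∃ x : Gr (N + 2), y = (gen j : Gr (N + 2)) * x := by
    intro j y hy
    have h := CliffordAlgebra.contractLeft_ι_mul (Q := (0 : QuadraticForm ℝ (Fin (N + 2) → ℝ)))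
      (d := LinearMap.proj j) (Pi.single j 1) y
    rw [show CliffordAlgebra.ι 0 (Pi.single j 1) * y = 0 from hy, map_zero] at h
    have hd : (LinearMap.proj j : (Fin (N + 2) → ℝ) →ₗ[ℝ] ℝ) (Pi.single j (1 : ℝ)) = 1 := by simp
    rw [hd, one_smul] at h
    exact ⟨_, sub_eq_zero.mp h.symm⟩
  have h1 : (eta₂ N * incl N D : Gr (N + 2)) = 0 := by
    obtain ⟨x, hx⟩ := key _ _ ((mul_assoc _ _ _).symm.trans h)
    have := congrArg (extend (incl N) 0 (eta₂ N)) hx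
    rw [map_mul (extend (incl N) 0 (eta₂ N)) (gen _) x] at this
    simpa using this.trans (congrArg (· * _) (extend_eta₁ (incl N) 0 (eta₂ N)))
  obtain ⟨x, hx⟩ := key _ _ h1
  have := congrArg (extend (GradedAlgHom.id ℝ _) 0 0) hx
  rw [map_mul (extend (GradedAlgHom.id ℝ _) 0 0) (gen _) x] at this
  simpa using this.trans (congrArg (· * _) (extend_eta₂ (GradedAlgHom.id ℝ _) 0 0))

/-- An element that is invariant under rescaling the two new generators contains them only
through their product. -/
lemma exists_eq_of_invariant {z : Gr (N + 2)}
    (h : extend (incl N) ((2 : ℝ) • eta₁ N) ((1 / 2 : ℝ) • eta₂ N) z = z) :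
    ∃ D : Gr N, z = incl N (extend (GradedAlgHom.id ℝ _) 0 0 z) + eta₁ N * eta₂ N * incl N D := by
  obtain ⟨A, B, C, D, rfl⟩ := exists_decomposition z
  -- Putting η₂ = 0 leaves 2η₁B = η₁B, and putting η₁ = 0 leaves ½η₂C = η₂C, so both mixed terms
  -- vanish.
  have e1 := congrArg (extend (incl N) (eta₁ N) 0) h
  have e2 := congrArg (extend (incl N) 0 (eta₂ N)) h
  simp only [map_add, map_mul, extend_incl, extend_eta₁, extend_eta₂, Submodule.coe_smul, map_smul,
    smul_mul_assoc, ZeroMemClass.coe_zero, zero_mul, smul_zero, add_zero, mul_zero,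
    add_right_inj] at e1 e2
  have h1 : (eta₁ N : Gr (N + 2)) * incl N B = 0 := by
    rw [two_smul] at e1; simpa using e1
  have h2 : (eta₂ N : Gr (N + 2)) * incl N C = 0 := by
    have := sub_eq_zero.mpr e2
    rw [← one_smul ℝ ((eta₂ N : Gr (N + 2)) * incl N C), smul_smul, ← sub_smul] at this
    exact (smul_eq_zero.mp this).resolve_left (by norm_num)
  refine ⟨D, ?_⟩
  simp [h1, h2]

end Gr
end Super

namespace Super

open Gr

/-! ### Natural functions on `Λ_0^p × Λ_1^q` -/

namespace Gr

variable {N N' : ℕ}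

/-- The restriction of a morphism of Grassmann algebras to the parts of a given parity. -/
def mapPart (ρ : GradedAlgHom ℝ (parity N) (parity N')) (i : ZMod 2) :
    parity N i →ₗ[ℝ] parity N' i :=
  ρ.toAlgHom.toLinearMap.restrict fun _ h => ρ.map_mem h

@[simp] lemma coe_mapPart (ρ : GradedAlgHom ℝ (parity N) (parity N')) (i : ZMod 2)
    (a : parity N i) : (mapPart ρ i a : Gr N') = ρ a := rfl

/-- The product of two odd elements. -/
def oddMul (b c : parity N 1) : parity N 0 := ⟨b * c, odd_mul_odd_mem b.2 c.2⟩

@[simp] lemma coe_oddMul (b c : parity N 1) : (oddMul b c : Gr N) = b * c := rfl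

lemma mapPart_oddMul (ρ : GradedAlgHom ℝ (parity N) (parity N')) (b c : parity N 1) :
    mapPart ρ 0 (oddMul b c) = oddMul (mapPart ρ 1 b) (mapPart ρ 1 c) :=
  Subtype.ext (map_mul ρ (b : Gr N) c)

@[simp] lemma mapPart_extend_eta₁ (ρ : GradedAlgHom ℝ (parity N) (parity N')) (b c : parity N' 1) :
    mapPart (extend ρ b c) 1 (eta₁ N) = b := Subtype.ext (extend_eta₁ ρ b c)

@[simp] lemma mapPart_extend_eta₂ (ρ : GradedAlgHom ℝ (parity N) (parity N')) (b c : parity N' 1) :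
    mapPart (extend ρ b c) 1 (eta₂ N) = c := Subtype.ext (extend_eta₂ ρ b c)

end Gr

namespace CoordSpace

variable {p q N N' N'' : ℕ}

/-- The action of a morphism of Grassmann algebras on `Λ_0^p × Λ_1^q`. -/
def map (ρ : GradedAlgHom ℝ (parity N) (parity N')) : CoordSpace p q N →ₗ[ℝ] CoordSpace p q N' :=
  ((mapPart ρ 0).compLeft (Fin p)).prodMap ((mapPart ρ 1).compLeft (Fin q))

@[simp] lemma map_fst (ρ : GradedAlgHom ℝ (parity N) (parity N')) (u : CoordSpace p q N)
    (i : Fin p) : ((map ρ u).1 i : Gr N') = ρ (u.1 i) := rfl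

@[simp] lemma map_snd (ρ : GradedAlgHom ℝ (parity N) (parity N')) (u : CoordSpace p q N)
    (j : Fin q) : ((map ρ u).2 j : Gr N') = ρ (u.2 j) := rfl

@[ext] lemma ext' {u v : CoordSpace p q N} (h1 : ∀ i, (u.1 i : Gr N) = v.1 i)
    (h2 : ∀ j, (u.2 j : Gr N) = v.2 j) : u = v :=
  Prod.ext (funext fun i => Subtype.ext (h1 i)) (funext fun j => Subtype.ext (h2 j))

lemma map_map (σ : GradedAlgHom ℝ (parity N') (parity N''))
    (ρ : GradedAlgHom ℝ (parity N) (parity N')) (u : CoordSpace p q N) :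
    map σ (map ρ u) = map (σ.comp ρ) u := rfl

lemma map_id (u : CoordSpace p q N) : map (GradedAlgHom.id ℝ _) u = u := rfl

/-- The vector of `Λ_0^p × Λ_1^q` with `w` as `i`-th even component and all other components
zero. -/
def evenDir (i : Fin p) : parity N 0 →ₗ[ℝ] CoordSpace p q N :=
  LinearMap.inl ℝ _ _ ∘ₗ LinearMap.single ℝ (fun _ => parity N 0) i

@[simp] lemma evenDir_fst (i k : Fin p) (w : parity N 0) :
    (((evenDir i w : CoordSpace p q N).1 k : parity N 0) : Gr N) =
      if k = i then (w : Gr N) else 0 := by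
  by_cases h : k = i
  · subst h; simp [evenDir]
  · simp [evenDir, h]

@[simp] lemma evenDir_snd (i : Fin p) (w : parity N 0) (j : Fin q) :
    (((evenDir i w : CoordSpace p q N).2 j : parity N 1) : Gr N) = 0 := rfl

lemma map_evenDir (ρ : GradedAlgHom ℝ (parity N) (parity N')) (i : Fin p) (w : parity N 0) :
    map ρ (evenDir i w : CoordSpace p q N) = evenDir i (mapPart ρ 0 w) := by
  ext k <;> simp
  split_ifs <;> simp

/-- The point of `Λ_0^p × Λ_1^q` with real even coordinates `a` and odd coordinates `θ`. -/
def ofReal (a : Fin p → ℝ) (θ : Fin q → parity N 1) : CoordSpace p q N :=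
  (fun i => ⟨algebraMap ℝ _ (a i), algebraMap_mem_even _⟩, θ)

@[simp] lemma ofReal_fst (a : Fin p → ℝ) (θ : Fin q → parity N 1) (i : Fin p) :
    ((ofReal a θ).1 i : Gr N) = algebraMap ℝ _ (a i) := rfl

@[simp] lemma ofReal_snd (a : Fin p → ℝ) (θ : Fin q → parity N 1) :
    (ofReal a θ).2 = θ := rfl

/-- The odd coordinates given by the generators of `Λ_q`. -/
def gens (q : ℕ) : Fin q → parity q 1 := fun j => ⟨gen j, gen_mem j⟩

/-- Universality of the generators: every point with real even coordinates is the image of the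
generic one over Λ_q, so a natural function is known at all of them once it is known over Λ_q. -/
lemma map_ofReal_gens (a : Fin p → ℝ) (θ : Fin q → parity N 1) :
    map (Gr.lift (superComm N) θ) (ofReal a (gens q)) = ofReal a θ := by
  ext k
  · simp
  · simp only [map_snd, ofReal_snd, gens, lift_gen]

/-- The bodies of the even coordinates. -/
def body (u : CoordSpace p q N) (i : Fin p) : ℝ := Gr.body (u.1 i : Gr N)

end CoordSpace

open CoordSpace

/-- The functions `Λ_0^p × Λ_1^q → Λ` that are natural in `Λ`. -/
def NatFun (p q : ℕ) : Submodule ℝ (∀ N, CoordSpace p q N → Gr N) where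
  carrier := {g | ∀ N N' (ρ : GradedAlgHom ℝ (parity N) (parity N')) (u : CoordSpace p q N),
    g N' (map ρ u) = ρ (g N u)}
  add_mem' hg hh N N' ρ u := by simp [hg N N' ρ u, hh N N' ρ u]
  zero_mem' _ _ _ _ := by simp
  smul_mem' c g hg N N' ρ u := by simp [hg N N' ρ u]

/-! ### Derivatives of natural functions in even directions -/

namespace NatFun

variable {p q : ℕ}

lemma map_apply (g : NatFun p q) {N N' : ℕ} (ρ : GradedAlgHom ℝ (parity N) (parity N'))
    (u : CoordSpace p q N) : g.1 N' (map ρ u) = ρ (g.1 N u) := g.2 N N' ρ u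

/-- `h` is the derivative of the natural function `g` in the `i`-th even direction. -/
def IsDeriv (i : Fin p) (g h : NatFun p q) : Prop :=
  ∀ (N : ℕ) (u : CoordSpace p q N) (b c : parity N 1),
    g.1 N (u + evenDir i (oddMul b c)) = g.1 N u + b * c * h.1 N u

/-- Inside Λ_N a product b * c has annihilators; the comparison is made in Λ_{N+2}, where η₁η₂ can
be cancelled against elements of Λ_N. -/
lemma IsDeriv.unique {i : Fin p} {g h h' : NatFun p q} (H : IsDeriv i g h) (H' : IsDeriv i g h') :
    h = h' := by
  refine Subtype.ext (funext fun N => funext fun u => ?_)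
  have h1 := H _ (map (incl N) u) (eta₁ N) (eta₂ N)
  rw [H' _ (map (incl N) u) (eta₁ N) (eta₂ N), add_right_inj, map_apply, map_apply] at h1
  refine (sub_eq_zero.mp (eq_zero_of_eta_mul ?_)).symm
  rw [map_sub, mul_sub, h1, sub_self]

/-- Naturality replaces differentiability: `g` at the point u + η₁η₂ e_i over Λ_{N+2} can involve
the new generators only through η₁η₂, and the coefficient is the derivative. -/
lemma exists_isDeriv (i : Fin p) (g : NatFun p q) : ∃ h, IsDeriv i g h := by
  have key : ∀ N (u : CoordSpace p q N), ∃ D : Gr N,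
      g.1 (N + 2) (map (incl N) u + evenDir i (oddMul (eta₁ N) (eta₂ N))) =
        incl N (g.1 N u) + eta₁ N * eta₂ N * incl N D := by
    intro N u
    set z := g.1 (N + 2) (map (incl N) u + evenDir i (oddMul (eta₁ N) (eta₂ N)))
    -- The rescaling preserves η₁η₂ and Λ_N, hence the argument of `g`.
    have hz : extend (incl N) ((2 : ℝ) • eta₁ N) ((1 / 2 : ℝ) • eta₂ N) z = z := by
      rw [← map_apply, map_add, map_map, extend_comp_incl, map_evenDir, mapPart_oddMul,
        mapPart_extend_eta₁, mapPart_extend_eta₂,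
        show oddMul ((2 : ℝ) • eta₁ N) ((1 / 2 : ℝ) • eta₂ N) = oddMul (eta₁ N) (eta₂ N) from
          Subtype.ext (by simp [smul_smul])]
    obtain ⟨D, hD⟩ := exists_eq_of_invariant hz
    refine ⟨D, hD.trans ?_⟩
    -- Killing both new generators takes the shifted point back to `u`.
    congr 2
    rw [← map_apply, map_add, map_map, extend_comp_incl, map_evenDir, map_id, mapPart_oddMul,
      mapPart_extend_eta₁, mapPart_extend_eta₂,
      show oddMul (0 : parity N 1) 0 = 0 from Subtype.ext (mul_zero _), map_zero, add_zero]
  choose D hD using key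
  -- Substitution of b, c for η₁, η₂ along an arbitrary ρ: the case ρ = id is the derivative
  -- property, and the case of `incl` after a morphism is needed for naturality of `D`.
  have hshift : ∀ (N N' : ℕ) (ρ : GradedAlgHom ℝ (parity N) (parity N')) (u : CoordSpace p q N)
      (b c : parity N' 1), g.1 N' (map ρ u + evenDir i (oddMul b c)) =
        ρ (g.1 N u) + b * c * ρ (D N u) := by
    intro N N' ρ u b c
    have := congrArg (extend ρ b c) (hD N u)
    rw [← map_apply, map_add, map_map, extend_comp_incl, map_evenDir, mapPart_oddMul,
      mapPart_extend_eta₁, mapPart_extend_eta₂] at this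
    simpa using this
  refine ⟨⟨D, fun N N' ρ u => ?_⟩, fun N u b c => hshift N N (GradedAlgHom.id ℝ _) u b c⟩
  -- Expanding the value at map ρ u + η₁η₂ e_i from `u` and from `map ρ u` gives the same element;
  -- cancelling η₁η₂ shows that `D` is natural.
  have h1 := hshift _ _ (incl N') (map ρ u) (eta₁ N') (eta₂ N')
  rw [map_map, hshift _ _ ((incl N').comp ρ) u (eta₁ N') (eta₂ N'), map_apply,
    GradedAlgHom.comp_apply, add_right_inj] at h1
  refine (sub_eq_zero.mp (eq_zero_of_eta_mul ?_)).symm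
  rw [map_sub, mul_sub, ← h1, GradedAlgHom.comp_apply, sub_self]

/-- The derivative of natural functions in the `i`-th even direction. -/
def deriv (i : Fin p) : NatFun p q →ₗ[ℝ] NatFun p q where
  toFun g := (exists_isDeriv i g).choose
  map_add' g h := by
    refine (exists_isDeriv i (g + h)).choose_spec.unique fun N u b c => ?_
    have h1 := (exists_isDeriv i g).choose_spec N u b c
    have h2 := (exists_isDeriv i h).choose_spec N u b c
    simp only [Submodule.coe_add, Pi.add_apply, h1, h2, mul_add]
    abel
  map_smul' r g := by
    refine (exists_isDeriv i (r • g)).choose_spec.unique fun N u b c => ?_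
    have h1 := (exists_isDeriv i g).choose_spec N u b c
    simp only [Submodule.coe_smul, Pi.smul_apply, h1, smul_add, RingHom.id_apply, mul_smul_comm]

lemma isDeriv_deriv (i : Fin p) (g : NatFun p q) : IsDeriv i g (deriv i g) :=
  (exists_isDeriv i g).choose_spec

lemma IsDeriv.deriv_eq {i : Fin p} {g h : NatFun p q} (H : IsDeriv i g h) : deriv i g = h :=
  (isDeriv_deriv i g).unique H

/-- Over Λ_{N+4}, with two independent pairs of new generators, the shifts in directions i and j can
be made in either order. The coefficients of the product of all four generators are the two mixed
derivatives. -/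
lemma deriv_comm (i j : Fin p) (g : NatFun p q) : deriv i (deriv j g) = deriv j (deriv i g) := by
  refine Subtype.ext (funext fun N => funext fun u => ?_)
  set u' := map (incl (N + 2)) (map (incl N) u) with hu'
  set b := mapPart (incl (N + 2)) 1 (eta₁ N) with hb
  set c := mapPart (incl (N + 2)) 1 (eta₂ N) with hc
  set E : Gr (N + 2 + 2) := eta₁ (N + 2) * eta₂ (N + 2)
  set A : Gr (N + 2 + 2) := b * c
  have h1 := isDeriv_deriv i g _ (u' + evenDir j (oddMul (eta₁ (N + 2)) (eta₂ (N + 2)))) b c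
  have h2 := isDeriv_deriv j g _ (u' + evenDir i (oddMul b c)) (eta₁ (N + 2)) (eta₂ (N + 2))
  rw [isDeriv_deriv j g _ u', isDeriv_deriv j (deriv i g) _ u'] at h1
  rw [isDeriv_deriv i g _ u', isDeriv_deriv i (deriv j g) _ u', add_right_comm u', h1] at h2
  change _ + E * _ + A * (_ + E * _) = _ + A * _ + E * (_ + A * _) at h2
  have hAE : A * E = E * A := ((superComm _).comm (oddMul b c).2 _).eq
  have h3 : E * (A * (deriv i (deriv j g)).1 _ u') = E * (A * (deriv j (deriv i g)).1 _ u') := by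
    rw [mul_add, mul_add, ← mul_assoc A, hAE, mul_assoc E A] at h2
    rw [← sub_eq_zero] at h2 ⊢
    rw [← neg_eq_zero, ← h2]
    abel
  have hA : A = incl (N + 2) (eta₁ N * eta₂ N) := by rw [map_mul]; rfl
  rw [hu', map_apply, map_apply, map_apply, map_apply, hA, ← map_mul, ← map_mul, ← sub_eq_zero,
    ← mul_sub, ← map_sub, ← mul_sub, ← map_sub] at h3
  exact sub_eq_zero.mp (eq_zero_of_eta_mul (eq_zero_of_eta_mul h3))

instance : LeftCommutative fun (i : Fin p) (g : NatFun p q) => deriv i g := ⟨deriv_comm⟩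

/-- Iterated derivatives of natural functions. -/
def iterDeriv (s : Multiset (Fin p)) (g : NatFun p q) : NatFun p q :=
  s.foldr (fun i g => deriv i g) g

@[simp] lemma iterDeriv_zero (g : NatFun p q) : iterDeriv 0 g = g := rfl

lemma iterDeriv_cons (i : Fin p) (s : Multiset (Fin p)) (g : NatFun p q) :
    iterDeriv (i ::ₘ s) g = deriv i (iterDeriv s g) := Multiset.foldr_cons _ _ _ _

lemma iterDeriv_cons' (i : Fin p) (s : Multiset (Fin p)) (g : NatFun p q) :
    iterDeriv (i ::ₘ s) g = iterDeriv s (deriv i g) := by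
  induction s using Multiset.induction_on with
  | empty => rfl
  | cons j s ih => rw [iterDeriv_cons, iterDeriv_cons, deriv_comm, ← iterDeriv_cons, ih,
      iterDeriv_cons]

lemma iterDeriv_sub (s : Multiset (Fin p)) (g h : NatFun p q) :
    iterDeriv s (g - h) = iterDeriv s g - iterDeriv s h := by
  induction s using Multiset.induction_on with
  | empty => rfl
  | cons j s ih => rw [iterDeriv_cons, ih, map_sub, iterDeriv_cons, iterDeriv_cons]

/-- A natural function is zero if all its iterated derivatives vanish at the points with real even
coordinates. -/
lemma eq_zero_of_iterDeriv (g : NatFun p q)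
    (hg : ∀ s a, (iterDeriv s g).1 q (ofReal a (gens q)) = 0) : g = 0 := by
  -- vanishing at `u` of all natural functions with the given property
  let V (N : ℕ) (u : CoordSpace p q N) : Prop := ∀ h : NatFun p q,
    (∀ s a, (iterDeriv s h).1 q (ofReal a (gens q)) = 0) → h.1 N u = 0
  have step : ∀ N (i : Fin p) (w : parity N 0), Gr.body (w : Gr N) = 0 → ∀ u : CoordSpace p q N,
      V N u → V N (u + evenDir i w) := by
    intro N i w hw u hu
    have hmem := nil_mem_span w.2
    rw [show nil (w : Gr N) = w by simp [nil, hw]] at hmem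
    -- Induction over sums of elements r • (b * c); the claim is for all `u`, because one summand
    -- moves the base point of the next.
    have gen' : ∀ a ∈ Submodule.span ℝ {w | ∃ b ∈ parity N 1, ∃ c ∈ parity N 1, b * c = w},
        ∃ ha : a ∈ parity N 0, ∀ u : CoordSpace p q N, V N u → V N (u + evenDir i ⟨a, ha⟩) := by
      intro a ha
      induction ha using Submodule.closure_induction with
      | zero => exact ⟨zero_mem _, fun u hu => by
          convert hu; convert add_zero u; exact map_zero (evenDir i)⟩
      | add x y _ _ hx hy =>
        obtain ⟨hx, hx'⟩ := hx
        obtain ⟨hy, hy'⟩ := hy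
        refine ⟨add_mem hx hy, fun u hu => ?_⟩
        convert hy' _ (hx' u hu) using 1
        rw [add_assoc, ← map_add]; rfl
      | smul_mem r x hx =>
        obtain ⟨b, hb, c, hc, rfl⟩ := hx
        refine ⟨Submodule.smul_mem _ _ (odd_mul_odd_mem hb hc), fun u hu h hh => ?_⟩
        -- The scalar is absorbed into the first odd factor. Both terms of the expansion vanish,
        -- since the derivative of `h` inherits the property of `h`.
        have := isDeriv_deriv i h N u (r • ⟨b, hb⟩) ⟨c, hc⟩
        rw [hu h hh, hu (deriv i h) fun s a => by rw [← iterDeriv_cons']; exact hh _ a, mul_zero,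
          add_zero] at this
        convert this
        simp
    obtain ⟨_, h'⟩ := gen' _ hmem
    exact h' u hu
  have real : ∀ N a (θ : Fin q → parity N 1), V N (ofReal a θ) := fun N a θ h hh => by
    rw [← map_ofReal_gens, map_apply, show h.1 q _ = 0 from hh 0 a, map_zero]
  refine Subtype.ext (funext fun N => funext fun u => ?_)
  suffices H : V N u from H g hg
  -- The point is reached from its body by one nilpotent shift in each even direction.
  have hsum : u = ofReal (CoordSpace.body u) u.2 +
      ∑ i, evenDir i ⟨nil (u.1 i : Gr N), nil_mem_even (u.1 i).2⟩ := by
    ext k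
    · simp only [Prod.fst_add, Prod.fst_sum, Pi.add_apply, Finset.sum_apply, Submodule.coe_add,
        Submodule.coe_sum, evenDir_fst, ofReal_fst, Finset.sum_ite_eq, Finset.mem_univ, if_true]
      exact (body_add_nil _).symm
    · simp only [Prod.snd_add, Prod.snd_sum, Pi.add_apply, Finset.sum_apply, Submodule.coe_add,
        Submodule.coe_sum, evenDir_snd, ofReal_snd, Finset.sum_const_zero, add_zero]
  rw [hsum]
  have : ∀ S : Finset (Fin p), V N (ofReal (CoordSpace.body u) u.2 +
      ∑ i ∈ S, evenDir i ⟨nil (u.1 i : Gr N), nil_mem_even (u.1 i).2⟩) := by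
    intro S
    induction S using Finset.induction_on with
    | empty => rw [Finset.sum_empty, add_zero]; exact real _ _ _
    | insert i S hi ih =>
      rw [Finset.sum_insert hi, add_comm (evenDir i _), ← add_assoc]
      exact step _ _ _ (body_nil _) _ ih
  exact this _

end NatFun
end Super

namespace Super

open Gr CoordSpace

/-! ### Evaluation of formal series -/

namespace Gr

variable {N N' : ℕ}

lemma parity_zero_or_one (i : ZMod 2) : i = 0 ∨ i = 1 := by revert i; decide

lemma disjoint_parity (i : ZMod 2) : Disjoint (parity N i) (parity N (i + 1)) := by
  have := (CliffordAlgebra.evenOdd_isCompl (0 : QuadraticForm ℝ (Fin N → ℝ))).disjoint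
  rcases parity_zero_or_one i with rfl | rfl
  · exact this
  · exact this.symm

/-- The product of the elements `θ_j`, `j ∈ J`, in increasing order. -/
def oddMonomial {q : ℕ} (θ : Fin q → parity N 1) (J : Finset (Fin q)) : Gr N :=
  ((J.sort (· ≤ ·)).map fun j => (θ j : Gr N)).prod

lemma oddMonomial_mem {q : ℕ} (θ : Fin q → parity N 1) (J : Finset (Fin q)) :
    oddMonomial θ J ∈ parity N (J.card : ZMod 2) := by
  have := list_prod_mem (𝒜 := parity N) ((J.sort (· ≤ ·)).map fun j => (θ j : Gr N)) (by
    simp only [List.mem_map]; rintro _ ⟨i, -, rfl⟩; exact (θ i).2)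
  simpa [oddMonomial] using this

lemma oddMonomial_gens {q : ℕ} (J : Finset (Fin q)) :
    oddMonomial (gens q) J = monomialBasis q J := (monomialBasis_apply J).symm

lemma map_oddMonomial {q : ℕ} (ρ : GradedAlgHom ℝ (parity N) (parity N'))
    (θ : Fin q → parity N 1) (J : Finset (Fin q)) :
    ρ (oddMonomial θ J) = oddMonomial (fun j => mapPart ρ 1 (θ j)) J := by
  rw [oddMonomial, map_list_prod, List.map_map]; rfl

end Gr

namespace CoordSpace

variable {p q N N' : ℕ}

/-- The nilpotent part of the `i`-th even coordinate, as a central element. -/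
def centralNil (u : CoordSpace p q N) (i : Fin p) : Subalgebra.center ℝ (Gr N) :=
  ⟨nil (u.1 i : Gr N), Subalgebra.mem_center_iff.mpr fun b =>
    ((commute_of_even (nil_mem_even (u.1 i).2) b).eq).symm⟩

/-- The monomial `x°^ν` in the nilpotent parts of the even coordinates. -/
def nilMonomial (u : CoordSpace p q N) (ν : Fin p → ℕ) : Gr N :=
  (List.ofFn fun i => nil (u.1 i : Gr N) ^ ν i).prod

/-- The even nilpotent parts lie in the centre, which is a commutative ring, so the ordered product
may be handled as a `Finset` product. -/
lemma nilMonomial_eq (u : CoordSpace p q N) (ν : Fin p → ℕ) :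
    nilMonomial u ν = ((∏ i, centralNil u i ^ ν i : Subalgebra.center ℝ (Gr N)) : Gr N) := by
  rw [← List.prod_ofFn, nilMonomial]
  change _ = (Subalgebra.center ℝ (Gr N)).val _
  rw [map_list_prod, List.map_ofFn]
  rfl

lemma nilMonomial_eq_zero {u : CoordSpace p q N} {ν : Fin p → ℕ} {i : Fin p}
    (h : nil (u.1 i : Gr N) ^ ν i = 0) : nilMonomial u ν = 0 := by
  rw [nilMonomial_eq, Finset.prod_eq_zero (Finset.mem_univ i) (Subtype.ext h)]
  rfl

lemma nilMonomial_mem (u : CoordSpace p q N) (ν : Fin p → ℕ) : nilMonomial u ν ∈ parity N 0 := by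
  have : ∀ l : List (Gr N), (∀ a ∈ l, a ∈ parity N 0) → l.prod ∈ parity N 0 := by
    intro l
    induction l with
    | nil => intro _; simpa using one_mem_even
    | cons a l ih =>
      intro hl
      rw [List.prod_cons]
      exact even_mul_mem (hl a (by simp)) (ih fun b hb => hl b (by simp [hb]))
  refine this _ fun a ha => ?_
  obtain ⟨i, rfl⟩ := List.mem_ofFn.mp ha
  have := SetLike.pow_mem_graded (A := parity N) (ν i) (nil_mem_even (u.1 i).2)
  simpa using this

lemma map_nilMonomial (ρ : GradedAlgHom ℝ (parity N) (parity N')) (u : CoordSpace p q N)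
    (ν : Fin p → ℕ) : nilMonomial (map ρ u) ν = ρ (nilMonomial u ν) := by
  rw [nilMonomial, nilMonomial, map_list_prod, List.map_ofFn]
  congr 2
  funext i
  simp [nil_map]

/-- An exponent above N kills an element of Λ_N without body, so only the ν bounded by N contribute
and each `finsum` over ν is a genuine finite sum. -/
lemma finite_support_nilMonomial (u : CoordSpace p q N) :
    (Function.support (nilMonomial u)).Finite := by
  refine (Set.finite_Iic (fun _ : Fin p => N)).subset fun ν hν i => ?_
  by_contra h
  exact hν (nilMonomial_eq_zero (pow_eq_zero_of_body_eq_zero (body_nil _) (not_le.mp h)))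

lemma add_pow_of_sq_zero {R : Type*} [CommRing R] {c w : R} (hw : w * w = 0) (k : ℕ) :
    (c + w) ^ (k + 1) = c ^ (k + 1) + (k + 1) * w * c ^ k := by
  induction k with
  | zero => simp
  | succ k ih =>
    rw [pow_succ, ih]
    push_cast
    linear_combination ((k + 1) * c ^ k) * hw

lemma prod_pow_add_single {R : Type*} [CommRing R] {c c' : Fin p → R} {w : R} (hw : w * w = 0)
    {i : Fin p} (hi : c' i = c i + w) (hne : ∀ j, j ≠ i → c' j = c j) {μ ν : Fin p → ℕ}
    (hμ : μ = ν + Pi.single i 1) :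
    ∏ j, c' j ^ μ j = ∏ j, c j ^ μ j + (ν i + 1) * (w * ∏ j, c j ^ ν j) := by
  have h1 : ∀ j ∈ Finset.univ.erase i, c' j ^ μ j = c j ^ ν j := fun j hj => by
    have := Finset.ne_of_mem_erase hj
    simp [hne j this, this, hμ]
  have h2 : ∀ j ∈ Finset.univ.erase i, c j ^ μ j = c j ^ ν j := fun j hj => by
    have := Finset.ne_of_mem_erase hj
    simp [this, hμ]
  have h3 : μ i = ν i + 1 := by simp [hμ]
  rw [← Finset.mul_prod_erase _ _ (Finset.mem_univ i), Finset.prod_congr rfl h1,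
    ← Finset.mul_prod_erase (f := fun j => c j ^ μ j) _ (Finset.mem_univ i),
    Finset.prod_congr rfl h2,
    ← Finset.mul_prod_erase (f := fun j => c j ^ ν j) _ (Finset.mem_univ i), h3, hi,
    add_pow_of_sq_zero hw]
  ring

/-- Since (bc)² = 0, the binomial expansion stops after the linear term. The exponent is written as
ν + e_i to avoid truncated subtraction. -/
lemma nilMonomial_add_evenDir (u : CoordSpace p q N) (i : Fin p) (b c : parity N 1)
    (ν : Fin p → ℕ) : nilMonomial (u + evenDir i (oddMul b c)) (ν + Pi.single i 1) =
      nilMonomial u (ν + Pi.single i 1) + ((ν i : ℝ) + 1) • (b * c * nilMonomial u ν : Gr N) := by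
  set w : Subalgebra.center ℝ (Gr N) := ⟨(b : Gr N) * (c : Gr N), Subalgebra.mem_center_iff.mpr fun x =>
    ((commute_of_even (oddMul b c).2 x).eq).symm⟩ with hwdef
  have hw : w * w = 0 := Subtype.ext ((superComm N).odd_mul_odd_sq b.2 c.2)
  have hbody : Gr.body (b * c : Gr N) = 0 := by rw [map_mul, body_of_odd b.2, zero_mul]
  have hi : centralNil (u + evenDir i (oddMul b c)) i = centralNil u i + w := by
    refine Subtype.ext ?_
    simp [centralNil, nil, hwdef, hbody]
    abel
  have hne : ∀ j, j ≠ i → centralNil (u + evenDir i (oddMul b c)) j = centralNil u j := by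
    intro j hj
    refine Subtype.ext ?_
    simp [centralNil, hj]
  have key := prod_pow_add_single hw hi hne (ν := ν) rfl
  rw [nilMonomial_eq, nilMonomial_eq, nilMonomial_eq, key, Algebra.smul_def, map_add, map_natCast,
    map_one]
  rfl

lemma nilMonomial_add_evenDir_of_eq_zero (u : CoordSpace p q N) (i : Fin p) (w : parity N 0)
    {ν : Fin p → ℕ} (hν : ν i = 0) : nilMonomial (u + evenDir i w) ν = nilMonomial u ν := by
  rw [nilMonomial, nilMonomial]
  congr 2
  funext j
  by_cases h : j = i
  · subst h; simp [hν]
  · simp [h]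

end CoordSpace

/-! ### Formal series as natural functions -/

namespace FormalSeries

variable {p q N : ℕ}

lemma evalAt_eq (F : FormalSeries p q) (u : CoordSpace p q N) :
    F.evalAt u = ∑ᶠ ν, ∑ J, F ν J (CoordSpace.body u) • (nilMonomial u ν * oddMonomial u.2 J) := rfl

/-- The monomial is taken at a second point `v` to cover also the shifted point, where body and odd
coordinates can be rewritten as those of `u`. -/
lemma finite_support_evalAt (F : FormalSeries p q) (u v : CoordSpace p q N) :
    (Function.support fun ν => ∑ J, F ν J (CoordSpace.body u) •
      (nilMonomial v ν * oddMonomial u.2 J)).Finite := by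
  refine (finite_support_nilMonomial v).subset fun ν hν h => hν ?_
  simp [h]

/-- The natural function given by a formal series. -/
def toNatFun : FormalSeries p q →ₗ[ℝ] NatFun p q where
  toFun F := ⟨fun _ u => F.evalAt u, fun N N' ρ u => by
    change F.evalAt _ = ρ (F.evalAt u)
    rw [evalAt_eq, evalAt_eq]
    refine Eq.trans ?_ (ρ.toAlgHom.toLinearMap.toAddMonoidHom.map_finsum
      (finite_support_evalAt F u u)).symm
    refine finsum_congr fun ν => ?_
    change _ = ρ _
    rw [map_sum]
    refine Finset.sum_congr rfl fun J _ => ?_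
    rw [map_smul, map_mul, map_oddMonomial, map_nilMonomial]
    congr 2
    funext i
    exact body_map ρ _⟩
  map_add' F G := by
    refine Subtype.ext (funext fun N => funext fun u => ?_)
    change evalAt (F + G) u = evalAt F u + evalAt G u
    rw [evalAt_eq, evalAt_eq, evalAt_eq, ← finsum_add_distrib (finite_support_evalAt F u u)
      (finite_support_evalAt G u u)]
    refine finsum_congr fun ν => ?_
    rw [← Finset.sum_add_distrib]
    exact Finset.sum_congr rfl fun J _ => add_smul _ _ _
  map_smul' c F := by
    refine Subtype.ext (funext fun N => funext fun u => ?_)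
    change evalAt (c • F) u = c • evalAt F u
    rw [evalAt_eq, evalAt_eq, smul_finsum' _ (finite_support_evalAt F u u)]
    refine finsum_congr fun ν => ?_
    rw [Finset.smul_sum]
    exact Finset.sum_congr rfl fun J _ => mul_smul _ _ _

lemma toNatFun_apply (F : FormalSeries p q) (u : CoordSpace p q N) :
    (toNatFun F).1 N u = F.evalAt u := rfl

/-- The formal partial derivative with respect to the `i`-th even variable. -/
def pderiv (i : Fin p) (F : FormalSeries p q) : FormalSeries p q :=
  fun ν J a => ((ν i : ℝ) + 1) * F (ν + Pi.single i 1) J a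

/-- The product bc has no body, so the shift does not move the arguments of the coefficient
functions and acts on the monomials alone. The algebraic derivative is thus the formal one in X_i,
and the coefficients are not differentiated. -/
lemma isDeriv_toNatFun (i : Fin p) (F : FormalSeries p q) :
    NatFun.IsDeriv i (toNatFun F) (toNatFun (pderiv i F)) := by
  intro N u b c
  set v := u + evenDir i (oddMul b c) with hv
  have hbody : Gr.body (b * c : Gr N) = 0 := by rw [map_mul, body_of_odd b.2, zero_mul]
  have hb : CoordSpace.body v = CoordSpace.body u := by
    funext j
    by_cases h : j = i <;> simp [CoordSpace.body, hv, h, hbody]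
  have hθ : v.2 = u.2 := by
    funext j; refine Subtype.ext ?_; simp [hv]
  simp only [toNatFun_apply]
  rw [← sub_eq_iff_eq_add', evalAt_eq, evalAt_eq, evalAt_eq, hb, hθ, ← finsum_sub_distrib
    (finite_support_evalAt F u v) (finite_support_evalAt F u u), mul_finsum' _ _
    (finite_support_evalAt (pderiv i F) u u)]
  -- Terms with ν_i = 0 are unchanged by the shift and cancel, so the sum can be reindexed by ν ↦ ν
  -- + e_i.
  have hinj : Function.Injective fun ν : Fin p → ℕ => ν + Pi.single i 1 :=
    add_left_injective _
  rw [← finsum_mem_univ, finsum_mem_inter_support_eq _ _ (Set.range fun ν : Fin p → ℕ =>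
    ν + Pi.single i 1), finsum_mem_range hinj]
  · refine finsum_congr fun ν => ?_
    rw [← Finset.sum_sub_distrib, Finset.mul_sum]
    refine Finset.sum_congr rfl fun J _ => ?_
    rw [hv, nilMonomial_add_evenDir, ← smul_sub, add_mul, add_sub_cancel_left, pderiv,
      smul_mul_assoc, smul_smul, mul_smul_comm, mul_assoc, mul_comm (F _ _ _)]
  · ext ν
    simp only [Set.univ_inter, Set.mem_inter_iff, iff_and_self]
    intro hν
    by_contra h
    refine hν ?_
    have h0 : ν i = 0 := by
      by_contra h0
      refine h ⟨ν - Pi.single i 1, ?_⟩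
      funext j
      by_cases hj : j = i
      · subst hj; simp; omega
      · simp [hj]
    simp [hv, nilMonomial_add_evenDir_of_eq_zero u i _ h0]

lemma evalAt_ofReal (F : FormalSeries p q) (a : Fin p → ℝ) (θ : Fin q → Gr.parity N 1) :
    F.evalAt (ofReal a θ) = ∑ J, F 0 J a • oddMonomial θ J := by
  have hb : CoordSpace.body (ofReal a θ) = a := by
    funext i; simp [CoordSpace.body]
  rw [evalAt_eq, finsum_eq_single _ 0, hb]
  · refine Finset.sum_congr rfl fun J _ => ?_
    simp [nilMonomial, ofReal_snd]
  · intro ν hν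
    obtain ⟨i, hi⟩ := Function.ne_iff.mp hν
    have : nilMonomial (ofReal a θ) ν = 0 :=
      nilMonomial_eq_zero (i := i) (by simp [nil, zero_pow hi])
    simp [this]

/-- Taylor's formula at the generic point (a, θ): only the exponent 0 survives there, and each
derivative lowers an exponent. It yields injectivity and prescribes the coefficients for
surjectivity. -/
lemma repr_iterDeriv_toNatFun (s : Multiset (Fin p)) (F : FormalSeries p q) (a : Fin p → ℝ)
    (J : Finset (Fin q)) :
    (monomialBasis q).repr ((NatFun.iterDeriv s (toNatFun F)).1 q (ofReal a (gens q))) J =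
      (∏ i, ((s.count i).factorial : ℝ)) * F (fun i => s.count i) J a := by
  induction s using Multiset.induction_on generalizing F with
  | empty =>
    rw [NatFun.iterDeriv_zero, toNatFun_apply, evalAt_ofReal]
    simp_rw [oddMonomial_gens]
    rw [Module.Basis.repr_sum_self]
    simp
    rfl
  | cons i s ih =>
    rw [NatFun.iterDeriv_cons', (isDeriv_toNatFun i F).deriv_eq, ih, pderiv]
    have h1 : (fun j => (i ::ₘ s).count j) = (fun j => s.count j) + Pi.single i 1 := by
      funext j
      by_cases h : j = i
      · subst h; simp
      · simp [h]
    have h2 : ∏ j, (((i ::ₘ s).count j).factorial : ℝ) =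
        (∏ j, ((s.count j).factorial : ℝ)) * (s.count i + 1) := by
      rw [← Finset.mul_prod_erase _ _ (Finset.mem_univ i),
        ← Finset.mul_prod_erase (f := fun j => ((s.count j).factorial : ℝ)) _ (Finset.mem_univ i)]
      have : ∏ j ∈ Finset.univ.erase i, (((i ::ₘ s).count j).factorial : ℝ) =
          ∏ j ∈ Finset.univ.erase i, ((s.count j).factorial : ℝ) :=
        Finset.prod_congr rfl fun j hj => by simp [Finset.ne_of_mem_erase hj]
      rw [this, Multiset.count_cons_self, Nat.factorial_succ]
      push_cast
      ring
    rw [h1, h2, mul_assoc]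

/-- The multiset with multiplicities `ν`. -/
def ofCounts (ν : Fin p → ℕ) : Multiset (Fin p) := ∑ i, Multiset.replicate (ν i) i

lemma count_ofCounts (ν : Fin p → ℕ) (i : Fin p) : (ofCounts ν).count i = ν i := by
  rw [ofCounts, Multiset.count_sum']
  simp [Multiset.count_replicate]

lemma ofCounts_count (s : Multiset (Fin p)) : ofCounts (fun i => s.count i) = s :=
  Multiset.ext.mpr fun i => count_ofCounts _ i

lemma prod_factorial_ne_zero (ν : Fin p → ℕ) : (∏ i, ((ν i).factorial : ℝ)) ≠ 0 :=
  Finset.prod_ne_zero_iff.mpr fun i _ => by exact_mod_cast (ν i).factorial_ne_zero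

/-- Formal series are the same as natural functions. -/
lemma toNatFun_bijective : Function.Bijective (toNatFun (p := p) (q := q)) := by
  constructor
  · rw [← LinearMap.ker_eq_bot, LinearMap.ker_eq_bot']
    intro F hF
    funext ν J a
    have := repr_iterDeriv_toNatFun (ofCounts ν) F a J
    have h0 : NatFun.iterDeriv (ofCounts ν) (0 : NatFun p q) = 0 := by
      simpa using NatFun.iterDeriv_sub (ofCounts ν) (0 : NatFun p q) 0
    rw [hF, h0] at this
    simp only [count_ofCounts] at this
    refine (mul_eq_zero.mp (Eq.trans this.symm ?_)).resolve_left (prod_factorial_ne_zero ν)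
    simp
  · intro g
    refine ⟨fun ν J a => (monomialBasis q).repr
      ((NatFun.iterDeriv (ofCounts ν) g).1 q (ofReal a (gens q))) J / ∏ i, ((ν i).factorial : ℝ), ?_⟩
    -- With these Taylor coefficients, the series and `g` have the same iterated derivatives at all
    -- generic points.
    refine sub_eq_zero.mp (NatFun.eq_zero_of_iterDeriv _ fun s a => ?_)
    rw [NatFun.iterDeriv_sub]
    refine (monomialBasis q).ext_elem fun J => ?_
    simp only [Submodule.coe_sub, Pi.sub_apply, map_sub, Finsupp.coe_sub, map_zero,
      Finsupp.coe_zero, Pi.zero_apply]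
    rw [repr_iterDeriv_toNatFun, ofCounts_count, mul_div_cancel₀ _ (prod_factorial_ne_zero _),
      sub_self]

lemma evalAt_mem {i : ZMod 2} {F : FormalSeries p q} (hF : F ∈ FormalSeries.parity p q i)
    (u : CoordSpace p q N) : F.evalAt u ∈ Gr.parity N i := by
  rw [evalAt_eq]
  refine finsum_induction (· ∈ Gr.parity N i) (zero_mem _) (fun _ _ => add_mem) fun ν => ?_
  refine sum_mem fun J _ => ?_
  by_cases h : (J.card : ZMod 2) = i
  · exact Submodule.smul_mem _ _ (even_mul_mem (nilMonomial_mem u ν) (h ▸ oddMonomial_mem _ _))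
  · rw [hF ν J h]; simp

/-- The part of `F` with the wrong parity takes values in both parities, hence only the value 0, and
so it vanishes as a series by injectivity. -/
lemma mem_parity_of_evalAt {i : ZMod 2} {F : FormalSeries p q}
    (hF : ∀ N (u : CoordSpace p q N), F.evalAt u ∈ Gr.parity N i) :
    F ∈ FormalSeries.parity p q i := by
  classical
  set G : FormalSeries p q := fun ν J => if (J.card : ZMod 2) = i then F ν J else 0 with hG
  have hGi : G ∈ FormalSeries.parity p q i := fun ν J h => by simp [hG, h]
  have hdec : ∀ i j : ZMod 2, j ≠ i + 1 → j = i := by decide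
  have hFG : F - G ∈ FormalSeries.parity p q (i + 1) := fun ν J h => by
    have : (J.card : ZMod 2) = i := hdec _ _ h
    simp [hG, this]
  have : toNatFun (F - G) = toNatFun 0 := by
    rw [map_zero]
    refine Subtype.ext (funext fun N => funext fun u => ?_)
    refine Submodule.disjoint_def.mp (disjoint_parity i) _ ?_ (evalAt_mem hFG u)
    rw [map_sub]
    exact sub_mem (hF N u) (evalAt_mem hGi u)
  rwa [sub_eq_zero.mp (toNatFun_bijective.1 this)]

end FormalSeries
end Super

namespace Super

open Gr CoordSpace

/-! ### Smooth functions on open subsets of `ℝ^p` -/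

/-- Integrals of smooth functions over a compact interval depend smoothly on parameters. -/
lemma contDiff_nat_intervalIntegral {H : Type} [NormedAddCommGroup H] [NormedSpace ℝ H]
    [FiniteDimensional ℝ H] (n : ℕ) {F : Type} [NormedAddCommGroup F] [NormedSpace ℝ F]
    {G : H × ℝ → F} (hG : ContDiff ℝ n G) :
    ContDiff ℝ n fun x => ∫ t in (0 : ℝ)..1, G (x, t) := by
  -- The target varies because the derivative in the parameter, to which the induction hypothesis is
  -- applied, has values in a space of linear maps.
  induction n generalizing F with
  | zero =>
    have hc : Continuous G := hG.continuous
    exact contDiff_zero.mpr (intervalIntegral.continuous_parametric_intervalIntegral_of_continuous'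
      (f := fun x t => G (x, t)) hc 0 1)
  | succ n ih =>
    have hG1 : ContDiff ℝ n (fun z => (fderiv ℝ G z).comp (ContinuousLinearMap.inl ℝ H ℝ)) :=
      (hG.fderiv_right (m := n) (by norm_cast)).clm_comp contDiff_const
    have hc1 := hG1.continuous
    have hc : Continuous G := hG.continuous
    have hdiff : ∀ x t, HasFDerivAt (fun y => G (y, t))
        ((fderiv ℝ G (x, t)).comp (ContinuousLinearMap.inl ℝ H ℝ)) x := fun x t => by
      have h1 : HasFDerivAt G (fderiv ℝ G (x, t)) (x, t) :=
        (hG.differentiable (by norm_cast) (x, t)).hasFDerivAt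
      exact h1.comp x (hasFDerivAt_prodMk_left x t)
    rw [Nat.cast_succ, contDiff_succ_iff_hasFDerivAt]
    refine ⟨_, ih hG1, fun x => ?_⟩
    have : ProperSpace H := FiniteDimensional.proper ℝ H
    -- Compactness of the closed unit ball times [0, 1] gives the constant bound for differentiation
    -- under the integral.
    obtain ⟨C, hC⟩ := ((isCompact_closedBall x 1).prod (isCompact_Icc (a := (0 : ℝ)) (b := 1))
      |>.exists_bound_of_continuousOn hc1.continuousOn)
    refine intervalIntegral.hasFDerivAt_integral_of_dominated_of_fderiv_le
      (F := fun x t => G (x, t))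
      (F' := fun x t => (fderiv ℝ G (x, t)).comp (ContinuousLinearMap.inl ℝ H ℝ))
      (bound := fun _ => C) (Metric.closedBall_mem_nhds x one_pos) ?_ ?_ ?_ ?_ ?_ ?_
    · exact Filter.Eventually.of_forall fun y =>
        (hc.comp (Continuous.prodMk_right y)).aestronglyMeasurable
    · exact (hc.comp (Continuous.prodMk_right x)).intervalIntegrable _ _
    · exact (hc1.comp (Continuous.prodMk_right x)).aestronglyMeasurable
    · refine Filter.Eventually.of_forall fun t ht y hy => hC (y, t) ⟨hy, ?_⟩
      rw [Set.uIoc_of_le zero_le_one] at ht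
      exact ⟨ht.1.le, ht.2⟩
    · exact intervalIntegrable_const
    · exact Filter.Eventually.of_forall fun t _ y _ => hdiff y t

lemma contDiff_intervalIntegral {H : Type} [NormedAddCommGroup H] [NormedSpace ℝ H]
    [FiniteDimensional ℝ H] {F : Type} [NormedAddCommGroup F] [NormedSpace ℝ F]
    {G : H × ℝ → F} (hG : ContDiff ℝ ∞ G) :
    ContDiff ℝ ∞ fun x => ∫ t in (0 : ℝ)..1, G (x, t) :=
  contDiff_infty.mpr fun n => contDiff_nat_intervalIntegral n (hG.of_le (by exact_mod_cast le_top))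

namespace SmoothFun

variable {p : ℕ} {U : Opens (Fin p → ℝ)}

lemma ext_eval {f g : SmoothFun p U} (h : ∀ x, eval x f = eval x g) : f = g :=
  ContMDiffMap.ext h

/-- The extension by zero of a smooth function to `ℝ^p`. -/
def ambient (f : SmoothFun p U) (x : Fin p → ℝ) : ℝ :=
  open Classical in if h : x ∈ U then eval ⟨x, h⟩ f else 0

lemma ambient_apply (f : SmoothFun p U) (x : U) : f.ambient x = eval x f := dif_pos x.2

lemma contDiffOn_ambient (f : SmoothFun p U) : ContDiffOn ℝ ∞ f.ambient U := by
  intro x hx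
  refine ContDiffAt.contDiffWithinAt ?_
  rw [← contMDiffAt_iff_contDiffAt]
  have h := contMDiffAt_subtype_iff (I := 𝓘(ℝ, Fin p → ℝ)) (I' := 𝓘(ℝ, ℝ)) (n := ∞)
    (f := f.ambient) (x := (⟨x, hx⟩ : U))
  refine h.mp ?_
  have : (fun x : U => f.ambient x) = fun x => eval x f := funext fun x => ambient_apply f x
  rw [this]
  exact ContMDiffMap.contMDiff f ⟨x, hx⟩

lemma contDiffAt_ambient (f : SmoothFun p U) (x : U) : ContDiffAt ℝ ∞ f.ambient x :=
  f.contDiffOn_ambient.contDiffAt (U.isOpen.mem_nhds x.2)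

/-- The smooth function on `U` given by a function on `ℝ^p` that is smooth on `U`. -/
def ofContDiffOn (F : (Fin p → ℝ) → ℝ) (hF : ContDiffOn ℝ ∞ F U) : SmoothFun p U :=
  (⟨fun x => F x, fun x => contMDiffAt_subtype_iff.mpr
    (contMDiffAt_iff_contDiffAt.mpr (hF.contDiffAt (U.isOpen.mem_nhds x.2)))⟩ :
      C^∞⟮𝓘(ℝ, Fin p → ℝ), U; 𝓘(ℝ, ℝ), ℝ⟯)

@[simp] lemma eval_ofContDiffOn (F : (Fin p → ℝ) → ℝ) (hF : ContDiffOn ℝ ∞ F U) (x : U) :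
    eval x (ofContDiffOn F hF) = F x := rfl

@[simp] lemma eval_coord (i : Fin p) (x : (⊤ : Opens (Fin p → ℝ))) :
    eval x (coord i) = x.1 i := rfl

@[simp] lemma eval_restrict {V : Opens (Fin p → ℝ)} (h : U ≤ V) (f : SmoothFun p V) (x : U) :
    eval x (restrict h f) = eval ⟨x.1, h x.2⟩ f := rfl

lemma ambient_eventuallyEq {f : SmoothFun p U} {F : (Fin p → ℝ) → ℝ} {x : U}
    (h : ∀ y : U, eval y f = F y) : f.ambient =ᶠ[nhds x.1] F := by
  filter_upwards [U.isOpen.mem_nhds x.2] with y hy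
  exact (ambient_apply f ⟨y, hy⟩).trans (h ⟨y, hy⟩)

/-- The partial derivative of a smooth function in the `i`-th direction. -/
def partialFun (i : Fin p) (f : SmoothFun p U) : SmoothFun p U :=
  ofContDiffOn (fun x => fderiv ℝ f.ambient x (Pi.single i 1))
    ((f.contDiffOn_ambient.fderiv_of_isOpen U.isOpen (by simp)).clm_apply contDiffOn_const)

lemma eval_partialFun (i : Fin p) (f : SmoothFun p U) (x : U) :
    eval x (partialFun i f) = fderiv ℝ f.ambient x (Pi.single i 1) := rfl

lemma eval_partialFun_eq {i : Fin p} {f : SmoothFun p U} {F : (Fin p → ℝ) → ℝ}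
    (h : ∀ y : U, eval y f = F y) (x : U) :
    eval x (partialFun i f) = fderiv ℝ F x (Pi.single i 1) := by
  rw [eval_partialFun, (ambient_eventuallyEq h).fderiv_eq]

/-- The derivation `∂/∂x_i` of the algebra of smooth functions. -/
def partialDeriv (i : Fin p) : Derivation ℝ (SmoothFun p U) (SmoothFun p U) :=
  Derivation.mk'
    { toFun := partialFun i
      map_add' := fun f g => ext_eval fun x => by
        rw [eval_partialFun_eq (F := f.ambient + g.ambient) (fun y => by
            rw [map_add, Pi.add_apply, ambient_apply, ambient_apply]),
          fderiv_add ((f.contDiffAt_ambient x).differentiableAt (by simp))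
            ((g.contDiffAt_ambient x).differentiableAt (by simp)), map_add]
        rfl
      map_smul' := fun c f => ext_eval fun x => by
        rw [eval_partialFun_eq (F := c • f.ambient) (fun y => by
            rw [map_smul, Pi.smul_apply, ambient_apply]),
          fderiv_const_smul ((f.contDiffAt_ambient x).differentiableAt (by simp)), RingHom.id_apply,
          map_smul]
        rfl }
    fun f g => ext_eval fun x => by
      change eval x (partialFun i (f * g)) = eval x (f * partialFun i g + g * partialFun i f)
      rw [eval_partialFun_eq (F := f.ambient * g.ambient) (fun y => by
            rw [map_mul, Pi.mul_apply, ambient_apply, ambient_apply]),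
          fderiv_mul ((f.contDiffAt_ambient x).differentiableAt (by simp))
            ((g.contDiffAt_ambient x).differentiableAt (by simp)), map_add, map_mul, map_mul,
          ← ambient_apply f, ← ambient_apply g]
      rfl

lemma eval_partialDeriv (i : Fin p) (f : SmoothFun p U) (x : U) :
    eval x (partialDeriv i f) = fderiv ℝ f.ambient x (Pi.single i 1) := rfl

lemma eval_partialDeriv_eq {i : Fin p} {f : SmoothFun p U} {F : (Fin p → ℝ) → ℝ}
    (h : ∀ y : U, eval y f = F y) (x : U) :
    eval x (partialDeriv i f) = fderiv ℝ F x (Pi.single i 1) := eval_partialFun_eq h x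

lemma partialDeriv_restrict {V : Opens (Fin p → ℝ)} (h : U ≤ V) (i : Fin p) (f : SmoothFun p V) :
    partialDeriv i (restrict h f) = restrict h (partialDeriv i f) :=
  ext_eval fun x => (eval_partialDeriv_eq (F := f.ambient)
    (fun y => by rw [eval_restrict, ← ambient_apply]) x).trans
      (eval_partialDeriv i f ⟨x.1, h x.2⟩).symm

lemma partialDeriv_coord (i j : Fin p) :
    partialDeriv i (coord j) = if i = j then 1 else 0 := ext_eval fun x => by
  rw [eval_partialDeriv_eq (F := fun y => y j) (fun y => eval_coord j y),
    show fderiv ℝ (fun y : Fin p → ℝ => y j) x.1 = ContinuousLinearMap.proj j from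
      (ContinuousLinearMap.proj (R := ℝ) (φ := fun _ : Fin p => ℝ) j).hasFDerivAt.fderiv]
  by_cases h : i = j
  · subst h; simp
  · simp [h]

lemma partialDeriv_comm (i j : Fin p) (f : SmoothFun p U) :
    partialDeriv i (partialDeriv j f) = partialDeriv j (partialDeriv i f) := ext_eval fun x => by
  have hd : DifferentiableAt ℝ (fderiv ℝ f.ambient) x.1 :=
    ((f.contDiffAt_ambient x).fderiv_right (m := ∞) (by simp)).differentiableAt (by simp)
  have key : ∀ i j, eval x (partialDeriv i (partialDeriv j f)) =
      fderiv ℝ (fderiv ℝ f.ambient) x (Pi.single i 1) (Pi.single j 1) := fun i j => by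
    rw [eval_partialDeriv_eq (F := fun y => fderiv ℝ f.ambient y (Pi.single j 1))
      (fun y => eval_partialDeriv j f y), fderiv_clm_apply hd (differentiableAt_const _)]
    simp
  rw [key, key]
  exact ((f.contDiffAt_ambient x).isSymmSndFDerivAt (by
    simpa using WithTop.coe_le_coe.mpr (le_top : (2 : ℕ∞) ≤ ⊤))).eq _ _

/-! ### Morphisms from smooth functions to Grassmann algebras -/

/-- Hadamard's lemma. -/
lemma exists_hadamard (f : SmoothFun p ⊤) (a : (⊤ : Opens (Fin p → ℝ))) :
    ∃ h : Fin p → SmoothFun p ⊤, f = algebraMap ℝ _ (eval a f) +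
      ∑ i, (coord i - algebraMap ℝ _ (a.1 i)) * h i := by
  have hf : ContDiff ℝ ∞ f.ambient := contDiffOn_univ.mp f.contDiffOn_ambient
  have hG : ∀ i : Fin p, ContDiff ℝ ∞ fun z : (Fin p → ℝ) × ℝ =>
      fderiv ℝ f.ambient (a.1 + z.2 • (z.1 - a.1)) (Pi.single i 1) := fun i =>
    ((hf.fderiv_right (m := ∞) (by simp)).comp (by fun_prop)).clm_apply contDiff_const
  -- The cofactors are h_i(x) = ∫₀¹ ∂_i f(a + t(x − a)) dt.
  refine ⟨fun i => ofContDiffOn _ (contDiff_intervalIntegral (hG i)).contDiffOn,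
    ext_eval fun x => ?_⟩
  have hderiv : ∀ t : ℝ, HasDerivAt (fun t : ℝ => f.ambient (a.1 + t • (x.1 - a.1)))
      (fderiv ℝ f.ambient (a.1 + t • (x.1 - a.1)) (x.1 - a.1)) t := fun t => by
    have h1 : HasDerivAt (fun t : ℝ => a.1 + t • (x.1 - a.1)) (x.1 - a.1) t := by
      simpa using ((hasDerivAt_id t).smul_const (x.1 - a.1)).const_add a.1
    exact ((hf.differentiable (by simp) _).hasFDerivAt).comp_hasDerivAt t h1
  have hcont : ∀ v, Continuous fun t : ℝ => fderiv ℝ f.ambient (a.1 + t • (x.1 - a.1)) v := fun v =>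
    ((hf.continuous_fderiv (by simp)).comp (by fun_prop)).clm_apply continuous_const
  have hint := intervalIntegral.integral_eq_sub_of_hasDerivAt (fun t _ => hderiv t)
    ((hcont _).intervalIntegrable 0 1)
  have hsum : ∀ t : ℝ, fderiv ℝ f.ambient (a.1 + t • (x.1 - a.1)) (x.1 - a.1) =
      ∑ i, (x.1 i - a.1 i) * fderiv ℝ f.ambient (a.1 + t • (x.1 - a.1)) (Pi.single i 1) := by
    intro t
    have := congrArg (fderiv ℝ f.ambient (a.1 + t • (x.1 - a.1))) (pi_eq_sum_univ' (x.1 - a.1))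
    rw [this, map_sum]
    simp
  simp_rw [hsum] at hint
  rw [intervalIntegral.integral_finsetSum fun i _ =>
    ((hcont _).const_mul _).intervalIntegrable 0 1] at hint
  simp only [intervalIntegral.integral_const_mul, one_smul, add_sub_cancel, zero_smul, add_zero]
    at hint
  rw [ambient_apply f x, ambient_apply f a] at hint
  simp only [map_add, map_sum, map_mul, map_sub, eval_coord, eval_ofContDiffOn, AlgHom.commutes,
    Algebra.algebraMap_self, RingHom.id_apply]
  rw [hint]
  ring

lemma exists_mul_eq_one {f : SmoothFun p U} (hf : ∀ x, eval x f ≠ 0) : ∃ g, f * g = 1 := by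
  refine ⟨ofContDiffOn (fun x => (f.ambient x)⁻¹) (f.contDiffOn_ambient.inv fun x hx => ?_),
    ext_eval fun x => ?_⟩
  · rw [ambient_apply f ⟨x, hx⟩]; exact hf _
  · rw [map_mul, eval_ofContDiffOn, ambient_apply, mul_inv_cancel₀ (hf x), map_one]

/-- A character of `C^∞(ℝ^p)` is the evaluation at a point. -/
lemma character_eq_eval (χ : SmoothFun p ⊤ →ₐ[ℝ] ℝ) :
    χ = eval (⟨fun i => χ (coord i), trivial⟩ : (⊤ : Opens (Fin p → ℝ))) := by
  refine AlgHom.ext fun f => ?_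
  by_contra hne
  set a : (⊤ : Opens (Fin p → ℝ)) := ⟨fun i => χ (coord i), trivial⟩ with ha
  -- This g lies in the kernel of χ. As a sum of squares it could vanish only at `a`, and only if
  -- f(a) = χ(f); otherwise it is invertible, which is impossible in the kernel.
  set g : SmoothFun p ⊤ := (f - algebraMap ℝ _ (χ f)) ^ 2 +
    ∑ i, (coord i - algebraMap ℝ _ (χ (coord i))) ^ 2 with hg
  have h0 : χ g = 0 := by simp [hg]
  have hpos : ∀ x, eval x g ≠ 0 := by
    intro x hx
    simp only [hg, map_add, map_pow, map_sub, map_sum, AlgHom.commutes, Algebra.algebraMap_self,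
      RingHom.id_apply, eval_coord] at hx
    have hs : 0 ≤ ∑ i, (x.1 i - χ (coord i)) ^ 2 := Finset.sum_nonneg fun i _ => sq_nonneg _
    have h1 : (eval x f - χ f) ^ 2 = 0 := by nlinarith [sq_nonneg (eval x f - χ f)]
    have h2 : ∑ i, (x.1 i - χ (coord i)) ^ 2 = 0 := by nlinarith [sq_nonneg (eval x f - χ f)]
    rw [Finset.sum_eq_zero_iff_of_nonneg fun i _ => sq_nonneg _] at h2
    have hxa : x = a := Subtype.ext (funext fun i =>
      sub_eq_zero.mp (pow_eq_zero_iff two_ne_zero |>.mp (h2 i (Finset.mem_univ i))))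
    rw [hxa] at h1
    exact hne (sub_eq_zero.mp (pow_eq_zero_iff two_ne_zero |>.mp h1)).symm
  obtain ⟨k, hk⟩ := exists_mul_eq_one hpos
  have := congrArg χ hk
  rw [map_mul, h0, zero_mul, map_one] at this
  exact zero_ne_one this

/-- A morphism from `C^∞(ℝ^p)` to a Grassmann algebra is determined by its values at the
coordinates. -/
lemma algHom_ext {N : ℕ} {φ ψ : SmoothFun p ⊤ →ₐ[ℝ] Gr N} (h : ∀ i, φ (coord i) = ψ (coord i)) :
    φ = ψ := by
  have hφ := character_eq_eval (body.comp φ)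
  have hψ := character_eq_eval (body.comp ψ)
  simp only [AlgHom.comp_apply, h] at hφ hψ
  set a : (⊤ : Opens (Fin p → ℝ)) := ⟨fun i => body (ψ (coord i)), trivial⟩ with ha
  -- Both morphisms have the same body, evaluation at `a`. Hadamard's lemma at `a` expresses φ f − ψ
  -- f through differences of the same kind with a factor in the augmentation ideal, so each step
  -- gains one power of this nilpotent ideal.
  have key : ∀ (k : ℕ) f, φ f - ψ f ∈ aug N ^ (k + 1) := by
    intro k
    induction k with
    | zero =>
      intro f
      have h1 : body (φ f) = eval a f := DFunLike.congr_fun hφ f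
      have h2 : body (ψ f) = eval a f := DFunLike.congr_fun hψ f
      rw [zero_add, pow_one, mem_aug, map_sub, h1, h2, sub_self]
    | succ k ih =>
      intro f
      obtain ⟨g, hg⟩ := exists_hadamard f a
      have : φ f - ψ f = ∑ i, (ψ (coord i) - algebraMap ℝ _ (a.1 i)) * (φ (g i) - ψ (g i)) := by
        rw [hg]
        simp only [map_add, map_sum, map_mul, map_sub, AlgHom.commutes, h]
        rw [add_sub_add_left_eq_sub, ← Finset.sum_sub_distrib]
        simp_rw [mul_sub]
      rw [this, pow_succ']
      refine sum_mem fun i _ => Submodule.mul_mem_mul ?_ (ih _)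
      rw [mem_aug]; simp [ha]
  refine AlgHom.ext fun f => sub_eq_zero.mp ?_
  have := key N f
  rwa [aug_pow_eq_bot, Submodule.mem_bot] at this

end SmoothFun
end Super

namespace Super

open Gr CoordSpace

/-! ### Shifts of morphisms by central elements of square zero -/

/-- Central elements of square zero. -/
structure CentralSqZero (R : Type*) [Ring R] where
  /-- the underlying element -/
  val : R
  sq : val * val = 0
  comm : ∀ r, Commute val r

section Shift

variable {C R ι : Type*} [CommRing C] [Algebra ℝ C] [Ring R] [Algebra ℝ R]

/-- The shift `f ↦ E f + w E (D f)` of an algebra morphism `E` along a derivation `D` and a central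
element `w` of square zero. -/
def shift (E : C →ₐ[ℝ] R) (D : Derivation ℝ C C) (w : CentralSqZero R) : C →ₐ[ℝ] R :=
  AlgHom.ofLinearMap (E.toLinearMap + LinearMap.mulLeft ℝ w.val ∘ₗ E.toLinearMap ∘ₗ D.toLinearMap)
    (by simp) fun f g => by
      simp only [LinearMap.add_apply, LinearMap.comp_apply, AlgHom.toLinearMap_apply,
        LinearMap.mulLeft_apply, Derivation.coeFn_coe, Derivation.leibniz, smul_eq_mul, map_add,
        map_mul]
      -- The only obstruction to multiplicativity is the product of the two correction terms, and it
      -- contains w².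
      have h1 : w.val * E (D f) * (w.val * E (D g)) = 0 := by
        rw [mul_assoc, ← mul_assoc (E (D f)), ← (w.comm (E (D f))).eq, ← mul_assoc, ← mul_assoc,
          w.sq, zero_mul, zero_mul]
      have h2 : w.val * (E f * E (D g)) = E f * (w.val * E (D g)) := by
        rw [← mul_assoc, (w.comm _).eq, mul_assoc]
      have h3 : w.val * (E g * E (D f)) = w.val * E (D f) * E g := by
        rw [← map_mul, mul_comm g, map_mul, mul_assoc]
      rw [add_mul, mul_add, mul_add, h1, add_zero, h2, h3]
      abel

/-- Successive shifts along a list of derivations and elements. -/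
def shiftList (D : ι → Derivation ℝ C C) (E : C →ₐ[ℝ] R) : List (ι × CentralSqZero R) → C →ₐ[ℝ] R
  | [] => E
  | t :: l => shift (shiftList D E l) (D t.1) t.2

lemma shiftList_cons (D : ι → Derivation ℝ C C) (E : C →ₐ[ℝ] R) (t : ι × CentralSqZero R)
    (l : List (ι × CentralSqZero R)) (f : C) :
    shiftList D E (t :: l) f = shiftList D E l f + t.2.val * shiftList D E l (D t.1 f) := rfl

lemma shiftList_mem {𝒜 : ZMod 2 → Submodule ℝ R} [GradedAlgebra 𝒜] (D : ι → Derivation ℝ C C)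
    {E : C →ₐ[ℝ] R} (hE : ∀ f, E f ∈ 𝒜 0) {l : List (ι × CentralSqZero R)}
    (hl : ∀ t ∈ l, t.2.val ∈ 𝒜 0) (f : C) : shiftList D E l f ∈ 𝒜 0 := by
  induction l generalizing f with
  | nil => exact hE f
  | cons t l ih =>
    have ih' := ih fun t ht => hl t (List.mem_cons_of_mem _ ht)
    rw [shiftList_cons]
    exact add_mem (ih' f) (even_mul_mem (hl t List.mem_cons_self) (ih' _))

/-- The derivatives of the coordinates are constants, so successive shifts produce no cross terms
and the elements simply add up. -/
lemma shiftList_coord [DecidableEq ι] (D : ι → Derivation ℝ C C) (E : C →ₐ[ℝ] R)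
    (l : List (ι × CentralSqZero R)) (x : ι → C) (hx : ∀ i j, D i (x j) = if i = j then 1 else 0)
    (j : ι) :
    shiftList D E l (x j) = E (x j) + (l.map fun t => if t.1 = j then t.2.val else 0).sum := by
  induction l with
  | nil => exact (add_zero _).symm
  | cons t l ih =>
    rw [shiftList_cons, ih, hx, List.map_cons, List.sum_cons]
    split_ifs
    · rw [map_one, mul_one]; abel
    · rw [map_zero, mul_zero]; abel

lemma comp_shiftList_eq {R' : Type*} [Ring R'] [Algebra ℝ R'] (D : ι → Derivation ℝ C C)
    (E : C →ₐ[ℝ] R) (ρ : R →ₐ[ℝ] R') (l : List (ι × CentralSqZero R)) (hl : ∀ t ∈ l, ρ t.2.val = 0)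
    (f : C) : ρ (shiftList D E l f) = ρ (E f) := by
  induction l generalizing f with
  | nil => rfl
  | cons t l ih =>
    rw [shiftList_cons, map_add, map_mul, hl t List.mem_cons_self, zero_mul, add_zero,
      ih fun t ht => hl t (List.mem_cons_of_mem _ ht)]

end Shift

/-! ### Morphisms on sections -/

namespace Sections

variable {p q : ℕ} {U : Opens (Fin p → ℝ)} {R : Type*} [Ring R] [Algebra ℝ R]
  {𝒜 : ZMod 2 → Submodule ℝ R} [GradedAlgebra 𝒜]

lemma algHom_ext {φ ψ : Sections p q U →ₐ[ℝ] R}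
    (h1 : ∀ f : SmoothFun p U, φ (f ⊗ₜ 1) = ψ (f ⊗ₜ 1))
    (h2 : ∀ j : Fin q, φ (1 ⊗ₜ gen j) = ψ (1 ⊗ₜ gen j)) : φ = ψ := by
  refine Algebra.TensorProduct.ext (AlgHom.ext h1) ?_
  exact Gr.algHom_ext h2

/-- The morphism on sections given by an even morphism on smooth functions and by odd elements. -/
def lift (h𝒜 : SuperComm 𝒜) (E : SmoothFun p U →ₐ[ℝ] R) (hE : ∀ f, E f ∈ 𝒜 0)
    (θ : Fin q → 𝒜 1) : GradedAlgHom ℝ (Sections.parity p q U) 𝒜 :=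
  { Algebra.TensorProduct.lift E (Gr.lift h𝒜 θ).toAlgHom (fun f _ => h𝒜.comm (hE f) _) with
    map_mem := by
      intro i x hx
      change x ∈ (Gr.parity q i).baseChange (SmoothFun p U) at hx
      change Algebra.TensorProduct.lift E (Gr.lift h𝒜 θ).toAlgHom
        (fun f _ => h𝒜.comm (hE f) _) x ∈ 𝒜 i
      rw [Submodule.baseChange_eq_span] at hx
      induction hx using Submodule.span_induction with
      | mem y hy =>
        obtain ⟨a, ha, rfl⟩ := hy
        simpa using (Gr.lift h𝒜 θ).map_mem ha
      | zero => simp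
      | add y z _ _ hy hz => rw [map_add]; exact add_mem hy hz
      | smul c y _ hy =>
        rw [Algebra.smul_def, map_mul]
        refine even_mul_mem ?_ hy
        rw [Algebra.TensorProduct.algebraMap_apply]
        simpa using hE c }

@[simp] lemma lift_tmul_one (h𝒜 : SuperComm 𝒜) (E : SmoothFun p U →ₐ[ℝ] R) (hE : ∀ f, E f ∈ 𝒜 0)
    (θ : Fin q → 𝒜 1) (f : SmoothFun p U) : lift h𝒜 E hE θ (f ⊗ₜ 1) = E f :=
  (Algebra.TensorProduct.lift_tmul _ _ (fun f _ => h𝒜.comm (hE f) _) _ _).trans (by simp)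

@[simp] lemma lift_one_tmul_gen (h𝒜 : SuperComm 𝒜) (E : SmoothFun p U →ₐ[ℝ] R)
    (hE : ∀ f, E f ∈ 𝒜 0) (θ : Fin q → 𝒜 1) (j : Fin q) : lift h𝒜 E hE θ (1 ⊗ₜ gen j) = θ j :=
  (Algebra.TensorProduct.lift_tmul _ _ (fun f _ => h𝒜.comm (hE f) _) _ _).trans
    (by simp [lift_gen])

end Sections

/-! ### Points from coordinates -/

namespace Gr

variable {N : ℕ}

/-- The multiple `c e_S` of a monomial of positive even degree (and zero for other monomials). -/
def monomialShift (c : ℝ) (S : Finset (Fin N)) : CentralSqZero (Gr N) :=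
  -- The empty set is excluded because 1 does not have square zero; odd monomials are excluded
  -- because they need not be central.
  ⟨if (S.card : ZMod 2) = 0 ∧ S.Nonempty then c • monomialBasis N S else 0, by
    split_ifs with h
    · rw [smul_mul_smul_comm, monomialBasis_mul_self h.2, smul_zero]
    · exact mul_zero 0, by
    intro r
    split_ifs with h
    · exact (commute_of_even (h.1 ▸ monomialBasis_mem S) r).smul_left c
    · exact Commute.zero_left r⟩

lemma monomialShift_mem (c : ℝ) (S : Finset (Fin N)) : (monomialShift c S).val ∈ parity N 0 := by
  unfold monomialShift
  dsimp only
  split_ifs with h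
  · exact Submodule.smul_mem _ _ (h.1 ▸ monomialBasis_mem S)
  · exact zero_mem _

lemma monomialShift_eq_smul (c : ℝ) (S : Finset (Fin N)) :
    (monomialShift c S).val = c • (monomialShift 1 S).val := by
  unfold monomialShift
  dsimp only
  split_ifs <;> simp

lemma body_monomialShift (c : ℝ) (S : Finset (Fin N)) : body (monomialShift c S).val = 0 := by
  unfold monomialShift
  dsimp only
  split_ifs with h
  · rw [map_smul, body_monomialBasis h.2, smul_zero]
  · exact map_zero _

/-- A general even nilpotent element need not have square zero, but it is a sum of multiples of
monomials that do. Hence a chain of shifts reaches every even element from its body. -/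
lemma sum_monomialShift {a : Gr N} (ha : a ∈ parity N 0) :
    ∑ S, (monomialShift ((monomialBasis N).repr a S) S).val = nil a := by
  have h := sum_repr_of_mem ha
  rw [nil, body_eq_repr, eq_sub_iff_add_eq]
  conv_rhs => rw [← h]
  rw [Finset.sum_filter, ← Finset.add_sum_erase _ _ (Finset.mem_univ ∅),
    ← Finset.add_sum_erase (f := fun S => if (S.card : ZMod 2) = 0 then
      (monomialBasis N).repr a S • monomialBasis N S else 0) _ (Finset.mem_univ ∅)]
  have h0 : (monomialShift ((monomialBasis N).repr a ∅) (∅ : Finset (Fin N))).val = 0 := by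
    simp [monomialShift]
  have h1 : ∀ S ∈ Finset.univ.erase (∅ : Finset (Fin N)),
      (monomialShift ((monomialBasis N).repr a S) S).val = if (S.card : ZMod 2) = 0 then
      (monomialBasis N).repr a S • monomialBasis N S else 0 := fun S hS => by
    simp [monomialShift, Finset.nonempty_iff_ne_empty.mpr (Finset.ne_of_mem_erase hS)]
  rw [h0, Finset.sum_congr rfl h1, Algebra.algebraMap_eq_smul_one]
  simp [add_comm]

end Gr

namespace CoordSpace

variable {p q N : ℕ}

/-- The shifts that lead from the body of `u` to `u`, restricted to a list of monomials. -/
def shifts (u : CoordSpace p q N) (l : List (Fin p × Finset (Fin N))) :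
    List (Fin p × CentralSqZero (Gr N)) :=
  l.map fun t => (t.1, monomialShift ((monomialBasis N).repr (u.1 t.1 : Gr N) t.2) t.2)

/-- The value at `u` of smooth functions, for the shifts in a given list of monomials. -/
def evalList (u : CoordSpace p q N) (l : List (Fin p × Finset (Fin N))) :
    SmoothFun p ⊤ →ₐ[ℝ] Gr N :=
  shiftList SmoothFun.partialDeriv ((Algebra.ofId ℝ (Gr N)).comp
    (SmoothFun.eval (⟨CoordSpace.body u, trivial⟩ : (⊤ : Opens (Fin p → ℝ))))) (shifts u l)

lemma evalList_mem (u : CoordSpace p q N) (l : List (Fin p × Finset (Fin N)))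
    (f : SmoothFun p ⊤) : evalList u l f ∈ parity N 0 := by
  refine shiftList_mem _ (fun f => algebraMap_mem_even _) (fun t ht => ?_) f
  obtain ⟨s, -, rfl⟩ := List.mem_map.mp ht
  exact monomialShift_mem _ _

/-- The value of smooth functions at the coordinates of a point over a Grassmann algebra. -/
def evalSmooth (u : CoordSpace p q N) : SmoothFun p ⊤ →ₐ[ℝ] Gr N :=
  evalList u Finset.univ.toList

lemma sum_toList_prod {m : ℕ} {ι M : Type*} [Fintype ι] [AddCommMonoid M] (w : Fin m × ι → M)
    (j : Fin m) : ((Finset.univ : Finset (Fin m × ι)).toList.map fun t =>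
      if t.1 = j then w t else 0).sum = ∑ s, w (j, s) := by
  rw [Finset.sum_map_toList, Fintype.sum_prod_type, Finset.sum_eq_single j]
  · simp
  · intro i _ hij; simp [hij]
  · simp

lemma evalSmooth_coord (u : CoordSpace p q N) (i : Fin p) :
    evalSmooth u (SmoothFun.coord i) = u.1 i := by
  rw [evalSmooth, evalList, shiftList_coord _ _ _ _ SmoothFun.partialDeriv_coord, shifts,
    List.map_map]
  have := sum_toList_prod (fun t : Fin p × Finset (Fin N) =>
    (monomialShift ((monomialBasis N).repr (u.1 t.1 : Gr N) t.2) t.2).val) i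
  refine (congrArg _ this).trans ?_
  dsimp only
  rw [sum_monomialShift (u.1 i).2]
  exact body_add_nil (u.1 i : Gr N)

/-- The point over `Λ_N` with given coordinates. -/
def toPoint (u : CoordSpace p q N) : GradedAlgHom ℝ (Sections.parity p q ⊤) (Gr.parity N) :=
  Sections.lift (superComm N) (evalSmooth u) (evalList_mem u _) u.2

lemma toPoint_tmul_one (u : CoordSpace p q N) (f : SmoothFun p ⊤) :
    toPoint u (f ⊗ₜ 1) = evalSmooth u f := Sections.lift_tmul_one _ _ _ _ _

lemma toPoint_one_tmul_gen (u : CoordSpace p q N) (j : Fin q) :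
    toPoint u (1 ⊗ₜ gen j) = u.2 j := Sections.lift_one_tmul_gen _ _ _ _ _

end CoordSpace

/-! ### Natural transformations as maps on coordinates -/

variable {p q : ℕ} {A B : GrassmannAlg}

/-- The point with given coordinates. -/
def ofCoords (u : CoordSpace p q A.gens) : (points p q).obj A := toPoint u

@[simp] lemma coords_ofCoords (u : CoordSpace p q A.gens) : coords (ofCoords u) = u := by
  ext k
  · exact (toPoint_tmul_one u _).trans (evalSmooth_coord u k)
  · exact toPoint_one_tmul_gen u k

/-- A morphism on sections is determined on C^∞ and on the θ_j, and on C^∞ already by the images of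
the x_i (`SmoothFun.algHom_ext`). -/
lemma coords_injective : Function.Injective (coords (p := p) (q := q) (A := A)) := by
  intro x y h
  refine GradedAlgHom.coe_toAlgHom_injective (Sections.algHom_ext (fun f => ?_) fun j => ?_)
  · have : (points.hom x).toAlgHom.comp Algebra.TensorProduct.includeLeft =
        (points.hom y).toAlgHom.comp Algebra.TensorProduct.includeLeft :=
      SmoothFun.algHom_ext fun i => congrArg (fun u : CoordSpace p q A.gens => (u.1 i : Gr A.gens)) h
    exact DFunLike.congr_fun this f
  · exact congrArg (fun u : CoordSpace p q A.gens => (u.2 j : Gr A.gens)) h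

@[simp] lemma ofCoords_coords (x : (points p q).obj A) : ofCoords (coords x) = x :=
  coords_injective (coords_ofCoords _)

/-- The morphism of superalgebras underlying a morphism of `GrassmannAlg`. -/
def GrassmannAlg.gradedHom (ρ : A ⟶ B) : GradedAlgHom ℝ (Gr.parity A.gens) (Gr.parity B.gens) :=
  ρ

lemma coords_map (ρ : A ⟶ B) (x : (points p q).obj A) :
    coords ((points p q).map ρ x) = CoordSpace.map (GrassmannAlg.gradedHom ρ) (coords x) := rfl

variable {m n : ℕ}

lemma points_naturality (α : points p q ⟶ points m n) (ρ : A ⟶ B) (x : (points p q).obj A) :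
    α.app B ((points p q).map ρ x) = (points m n).map ρ (α.app A x) :=
  NatTrans.naturality_apply α ρ x

/-- The map on coordinates given by a natural transformation. -/
def coordMap (α : points p q ⟶ points m n) (N : ℕ) (u : CoordSpace p q N) : CoordSpace m n N :=
  coords (α.app ⟨N⟩ (ofCoords (A := ⟨N⟩) u))

lemma coords_app (α : points p q ⟶ points m n) (x : (points p q).obj A) :
    coords (α.app A x) = coordMap α A.gens (coords x) := by
  rw [coordMap, ofCoords_coords]

lemma coordMap_map (α : points p q ⟶ points m n) {N N' : ℕ}
    (ρ : GradedAlgHom ℝ (Gr.parity N) (Gr.parity N')) (u : CoordSpace p q N) :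
    coordMap α N' (CoordSpace.map ρ u) = CoordSpace.map ρ (coordMap α N u) := by
  let ρ' : (⟨N⟩ : GrassmannAlg) ⟶ ⟨N'⟩ := ρ
  have h : ofCoords (A := ⟨N'⟩) (CoordSpace.map ρ u) =
      (points p q).map ρ' (ofCoords (A := ⟨N⟩) u) :=
    coords_injective (by rw [coords_ofCoords, coords_map, coords_ofCoords]; rfl)
  rw [coordMap, h, points_naturality, coords_map]
  rfl

lemma natTrans_ext {α β : points p q ⟶ points m n}
    (h : ∀ N (u : CoordSpace p q N), coordMap α N u = coordMap β N u) : α = β := by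
  refine NatTrans.ext (funext fun A => ?_)
  refine ConcreteCategory.hom_ext _ _ fun x => ?_
  exact coords_injective (by rw [coords_app, coords_app, h])

/-- The natural transformation given by maps on coordinates. -/
def ofCoordMap (f : ∀ N, CoordSpace p q N → CoordSpace m n N)
    (hf : ∀ N N' (ρ : GradedAlgHom ℝ (Gr.parity N) (Gr.parity N')) (u : CoordSpace p q N),
      f N' (CoordSpace.map ρ u) = CoordSpace.map ρ (f N u)) : points p q ⟶ points m n where
  app A := ↾(fun x : (points p q).obj A => ofCoords (f A.gens (coords x)))
  naturality A B ρ := by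
    refine ConcreteCategory.hom_ext _ _ fun x => ?_
    refine coords_injective ?_
    change coords (ofCoords (f B.gens (coords ((points p q).map ρ x)))) =
      coords ((points m n).map ρ (ofCoords (f A.gens (coords x))))
    rw [coords_ofCoords, coords_map, coords_map, coords_ofCoords, hf]

lemma coords_ofCoordMap (f : ∀ N, CoordSpace p q N → CoordSpace m n N)
    (hf : ∀ N N' (ρ : GradedAlgHom ℝ (Gr.parity N) (Gr.parity N')) (u : CoordSpace p q N),
      f N' (CoordSpace.map ρ u) = CoordSpace.map ρ (f N u)) (x : (points p q).obj A) :
    coords ((ofCoordMap f hf).app A x) = f A.gens (coords x) :=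
  coords_ofCoords (f A.gens (coords x))

lemma coordMap_ofCoordMap (f : ∀ N, CoordSpace p q N → CoordSpace m n N)
    (hf : ∀ N N' (ρ : GradedAlgHom ℝ (Gr.parity N) (Gr.parity N')) (u : CoordSpace p q N),
      f N' (CoordSpace.map ρ u) = CoordSpace.map ρ (f N u)) (N : ℕ) (u : CoordSpace p q N) :
    coordMap (ofCoordMap f hf) N u = f N u := by
  rw [coordMap, coords_ofCoordMap, coords_ofCoords]

/-! ### Natural transformations as tuples of formal series -/

/-- The natural transformation given by a tuple of formal series. -/
def seriesNatTrans
    (F : (Fin m → FormalSeries.parity p q 0) × (Fin n → FormalSeries.parity p q 1)) :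
    points p q ⟶ points m n :=
  ofCoordMap (fun _ u => (fun k => ⟨(F.1 k).1.evalAt u, FormalSeries.evalAt_mem (F.1 k).2 u⟩,
      fun l => ⟨(F.2 l).1.evalAt u, FormalSeries.evalAt_mem (F.2 l).2 u⟩))
    fun _ _ ρ u => by
      ext k
      · exact NatFun.map_apply (FormalSeries.toNatFun (F.1 k).1) ρ u
      · exact NatFun.map_apply (FormalSeries.toNatFun (F.2 k).1) ρ u

lemma seriesNatTrans_bijective :
    Function.Bijective (seriesNatTrans (p := p) (q := q) (m := m) (n := n)) := by
  constructor
  · intro F G h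
    have h' : ∀ N (u : CoordSpace p q N), coordMap (seriesNatTrans F) N u =
        coordMap (seriesNatTrans G) N u := fun N u => by rw [h]
    simp only [seriesNatTrans, coordMap_ofCoordMap] at h'
    refine Prod.ext (funext fun k => Subtype.ext (FormalSeries.toNatFun_bijective.1
      (Subtype.ext (funext fun N => funext fun u => ?_)))) (funext fun k => Subtype.ext
      (FormalSeries.toNatFun_bijective.1 (Subtype.ext (funext fun N => funext fun u => ?_))))
    · exact congrArg (fun v : CoordSpace m n N => (v.1 k : Gr N)) (h' N u)
    · exact congrArg (fun v : CoordSpace m n N => (v.2 k : Gr N)) (h' N u)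
  · intro α
    have h0 : ∀ k, ∃ F : FormalSeries.parity p q 0, ∀ N (u : CoordSpace p q N),
        F.1.evalAt u = (coordMap α N u).1 k := fun k => by
      obtain ⟨F, hF⟩ := FormalSeries.toNatFun_bijective.2
        ⟨fun N u => (coordMap α N u).1 k, fun N N' ρ u =>
          congrArg (fun v : CoordSpace m n N' => (v.1 k : Gr N')) (coordMap_map α ρ u)⟩
      have hF' : ∀ N (u : CoordSpace p q N), F.evalAt u = (coordMap α N u).1 k := fun N u =>
        congrFun (congrFun (congrArg Subtype.val hF) N) u
      exact ⟨⟨F, FormalSeries.mem_parity_of_evalAt fun N u => hF' N u ▸ Subtype.prop _⟩, hF'⟩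
    have h1 : ∀ k, ∃ F : FormalSeries.parity p q 1, ∀ N (u : CoordSpace p q N),
        F.1.evalAt u = (coordMap α N u).2 k := fun k => by
      obtain ⟨F, hF⟩ := FormalSeries.toNatFun_bijective.2
        ⟨fun N u => (coordMap α N u).2 k, fun N N' ρ u =>
          congrArg (fun v : CoordSpace m n N' => (v.2 k : Gr N')) (coordMap_map α ρ u)⟩
      have hF' : ∀ N (u : CoordSpace p q N), F.evalAt u = (coordMap α N u).2 k := fun N u =>
        congrFun (congrFun (congrArg Subtype.val hF) N) u
      exact ⟨⟨F, FormalSeries.mem_parity_of_evalAt fun N u => hF' N u ▸ Subtype.prop _⟩, hF'⟩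
    choose F hF using h0
    choose G hG using h1
    refine ⟨(F, G), natTrans_ext fun N u => ?_⟩
    rw [seriesNatTrans, coordMap_ofCoordMap]
    ext k
    · exact hF k N u
    · exact hG k N u

/-- Natural transformations between functors of points correspond to tuples of formal series. -/
theorem exists_equiv_formalSeries (p q m n : ℕ) :
    ∃ e : (points p q ⟶ points m n) ≃
        (Fin m → FormalSeries.parity p q 0) × (Fin n → FormalSeries.parity p q 1),
      ∀ (α : points p q ⟶ points m n) (A : GrassmannAlg) (x : (points p q).obj A),
        (∀ k, ((coords (α.app A x)).1 k : Gr A.gens) =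
          FormalSeries.evalAt ((e α).1 k) (coords x)) ∧
        (∀ l, ((coords (α.app A x)).2 l : Gr A.gens) =
          FormalSeries.evalAt ((e α).2 l) (coords x)) := by
  refine ⟨(Equiv.ofBijective _ seriesNatTrans_bijective).symm, fun α A x => ?_⟩
  obtain ⟨F, rfl⟩ := seriesNatTrans_bijective.2 α
  rw [Equiv.ofBijective_symm_apply_apply]
  constructor
  · intro k
    rw [seriesNatTrans, coords_ofCoordMap]
  · intro k
    rw [seriesNatTrans, coords_ofCoordMap]

end Super

namespace Super

open Gr CoordSpace

/-! ### Smooth functions with `Λ_0`-linear differential -/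

section

attribute [local instance] Gr.normedAddCommGroup Gr.normedSpace

instance Gr.instFiniteDimensional (N : ℕ) : FiniteDimensional ℝ (Gr N) :=
  Module.Finite.of_basis (monomialBasis N)

/-- Multiplication of the Grassmann algebra as a continuous bilinear map. -/
def Gr.mulL (N : ℕ) : Gr N →L[ℝ] Gr N →L[ℝ] Gr N :=
  LinearMap.toContinuousLinearMap
    ((LinearMap.toContinuousLinearMap : (Gr N →ₗ[ℝ] Gr N) ≃ₗ[ℝ] (Gr N →L[ℝ] Gr N)).toLinearMap ∘ₗ
      LinearMap.mul ℝ (Gr N))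

variable {p q m n N : ℕ}

lemma contDiff_gr_mul {E : Type*} [NormedAddCommGroup E] [NormedSpace ℝ E] {g h : E → Gr N}
    (hg : ContDiff ℝ ∞ g) (hh : ContDiff ℝ ∞ h) : ContDiff ℝ ∞ fun u => g u * h u :=
  ((Gr.mulL N).contDiff.comp hg).clm_apply hh

lemma fderiv_gr_mul {E : Type*} [NormedAddCommGroup E] [NormedSpace ℝ E] {g h : E → Gr N}
    (hg : ContDiff ℝ ∞ g) (hh : ContDiff ℝ ∞ h) (u v : E) :
    fderiv ℝ (fun u => g u * h u) u v = g u * fderiv ℝ h u v + fderiv ℝ g u v * h u := by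
  have h1 := (Gr.mulL N).hasFDerivAt_of_bilinear (hg.differentiable (by simp) u).hasFDerivAt
    (hh.differentiable (by simp) u).hasFDerivAt
  have h2 : HasFDerivAt (fun u => g u * h u) _ u := h1
  rw [h2.fderiv]
  rfl

/-- A function `Λ_0^p × Λ_1^q → Λ` that is smooth with `Λ_0`-linear differential. -/
def EvenSmooth (g : CoordSpace p q N → Gr N) : Prop :=
  ContDiff ℝ ∞ g ∧ ∀ (u v : CoordSpace p q N) (c : Gr.parity N 0),
    fderiv ℝ g u (evenSMul c v) = c.1 * fderiv ℝ g u v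

namespace EvenSmooth

variable {g h : CoordSpace p q N → Gr N}

lemma const (a : Gr N) : EvenSmooth fun _ : CoordSpace p q N => a :=
  ⟨contDiff_const, fun u v c => by simp⟩

lemma add (hg : EvenSmooth g) (hh : EvenSmooth h) : EvenSmooth fun u => g u + h u :=
  ⟨hg.1.add hh.1, fun u v c => by
    rw [fderiv_fun_add (hg.1.differentiable (by simp) u) (hh.1.differentiable (by simp) u)]
    simp only [add_apply, hg.2, hh.2, mul_add]⟩

lemma sub (hg : EvenSmooth g) (hh : EvenSmooth h) : EvenSmooth fun u => g u - h u :=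
  ⟨hg.1.sub hh.1, fun u v c => by
    rw [fderiv_fun_sub (hg.1.differentiable (by simp) u) (hh.1.differentiable (by simp) u)]
    simp only [sub_apply, hg.2, hh.2, mul_sub]⟩

lemma mul (hg : EvenSmooth g) (hh : EvenSmooth h) : EvenSmooth fun u => g u * h u :=
  ⟨contDiff_gr_mul hg.1 hh.1, fun u v c => by
    rw [fderiv_gr_mul hg.1 hh.1, fderiv_gr_mul hg.1 hh.1, hg.2, hh.2, mul_add, ← mul_assoc,
      ← (commute_of_even c.2 (g u)).eq, mul_assoc, mul_assoc]⟩

lemma of_linear (L : CoordSpace p q N →ₗ[ℝ] Gr N)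
    (hL : ∀ (c : Gr.parity N 0) v, L (evenSMul c v) = c.1 * L v) : EvenSmooth L := by
  refine ⟨(LinearMap.toContinuousLinearMap L).contDiff, fun u v c => ?_⟩
  have : fderiv ℝ L u = LinearMap.toContinuousLinearMap L :=
    (LinearMap.toContinuousLinearMap L).hasFDerivAt.fderiv
  rw [this]
  exact hL c v

end EvenSmooth

/-- The projection to an even coordinate. -/
def CoordSpace.projEven (i : Fin p) : CoordSpace p q N →ₗ[ℝ] Gr N :=
  (Gr.parity N 0).subtype ∘ₗ LinearMap.proj i ∘ₗ LinearMap.fst ℝ _ _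

/-- The projection to an odd coordinate. -/
def CoordSpace.projOdd (j : Fin q) : CoordSpace p q N →ₗ[ℝ] Gr N :=
  (Gr.parity N 1).subtype ∘ₗ LinearMap.proj j ∘ₗ LinearMap.snd ℝ _ _

@[simp] lemma CoordSpace.projEven_apply (i : Fin p) (u : CoordSpace p q N) :
    projEven i u = u.1 i := rfl

@[simp] lemma CoordSpace.projOdd_apply (j : Fin q) (u : CoordSpace p q N) :
    projOdd j u = u.2 j := rfl

/-- The component of an even coordinate of a vector in a given monomial. -/
def shiftComp (t : Fin p × Finset (Fin N)) : CoordSpace p q N →ₗ[ℝ] Gr N :=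
  ((monomialBasis N).coord t.2 ∘ₗ projEven t.1).smulRight (monomialShift 1 t.2).val

lemma shiftComp_apply (t : Fin p × Finset (Fin N)) (u : CoordSpace p q N) : shiftComp t u =
    (monomialShift ((monomialBasis N).repr (u.1 t.1 : Gr N) t.2) t.2).val :=
  (monomialShift_eq_smul _ _).symm

/-- Both factors are multiples of the same monomial of square zero, or zero. -/
lemma shiftComp_mul_shiftComp (t : Fin p × Finset (Fin N)) (u v : CoordSpace p q N) :
    shiftComp t u * shiftComp t v = 0 := by
  rw [shiftComp_apply, shiftComp_apply, monomialShift_eq_smul,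
    monomialShift_eq_smul ((monomialBasis N).repr (v.1 t.1 : Gr N) t.2), smul_mul_smul_comm,
    (monomialShift 1 t.2).sq, smul_zero]

/-- The part of the `i`-th even coordinate of a vector in the body and the given monomials. -/
def partialCoord (l : List (Fin p × Finset (Fin N))) (i : Fin p) (v : CoordSpace p q N) : Gr N :=
  algebraMap ℝ _ (CoordSpace.body v i) + (l.map fun t => if t.1 = i then shiftComp t v else 0).sum

lemma evalList_cons (t : Fin p × Finset (Fin N)) (l : List (Fin p × Finset (Fin N)))
    (u : CoordSpace p q N) (f : SmoothFun p ⊤) : evalList u (t :: l) f =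
      evalList u l f + shiftComp t u * evalList u l (SmoothFun.partialDeriv t.1 f) := by
  rw [shiftComp_apply]; rfl

/-- The bodies of the even coordinates, as a linear map. -/
def bodyL : CoordSpace p q N →L[ℝ] Fin p → ℝ :=
  LinearMap.toContinuousLinearMap (LinearMap.pi fun i => Gr.body.toLinearMap ∘ₗ projEven i)

/-- An explicit differential is proved because Λ_0-linearity does not survive in the induction: for
an incomplete list of monomials the differential sees only part of the vector and need not be
Λ_0-linear. -/
lemma evalList_smooth (l : List (Fin p × Finset (Fin N))) (f : SmoothFun p ⊤) :
    ContDiff ℝ ∞ (fun u : CoordSpace p q N => evalList u l f) ∧ ∀ u v : CoordSpace p q N,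
      fderiv ℝ (fun u => evalList u l f) u v =
        ∑ i, partialCoord l i v * evalList u l (SmoothFun.partialDeriv i f) := by
  induction l generalizing f with
  | nil =>
    have hf : ContDiff ℝ ∞ f.ambient := contDiffOn_univ.mp f.contDiffOn_ambient
    let ι : ℝ →L[ℝ] Gr N := LinearMap.toContinuousLinearMap (Algebra.linearMap ℝ (Gr N))
    have heq : (fun u : CoordSpace p q N => evalList u [] f) =
        fun u => ι (f.ambient (bodyL u)) := funext fun u =>
      congrArg (algebraMap ℝ (Gr N)) (SmoothFun.ambient_apply f ⟨CoordSpace.body u, trivial⟩).symm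
    rw [heq]
    refine ⟨ι.contDiff.comp (hf.comp bodyL.contDiff), fun u v => ?_⟩
    have hd : HasFDerivAt (fun u : CoordSpace p q N => ι (f.ambient (bodyL u)))
        (ι.comp ((fderiv ℝ f.ambient (bodyL u)).comp bodyL)) u :=
      ι.hasFDerivAt.comp u ((hf.differentiable (by simp) _).hasFDerivAt.comp u bodyL.hasFDerivAt)
    rw [hd.fderiv]
    have h1 : (bodyL v : Fin p → ℝ) = ∑ i, (bodyL v) i • Pi.single i 1 := pi_eq_sum_univ' _
    change ι (fderiv ℝ f.ambient (bodyL u) (bodyL v)) = _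
    conv_lhs => rw [h1]
    rw [map_sum, map_sum]
    refine Finset.sum_congr rfl fun i _ => ?_
    rw [map_smul, smul_eq_mul]
    simp only [partialCoord, List.map_nil, List.sum_nil, add_zero]
    exact map_mul (algebraMap ℝ (Gr N)) _ _
  | cons t l ih =>
    have heq : (fun u : CoordSpace p q N => evalList u (t :: l) f) = fun u =>
        evalList u l f + shiftComp t u * evalList u l (SmoothFun.partialDeriv t.1 f) :=
      funext fun u => evalList_cons t l u f
    obtain ⟨h1, h1'⟩ := ih f
    obtain ⟨h2, h2'⟩ := ih (SmoothFun.partialDeriv t.1 f)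
    have h3 : ContDiff ℝ ∞ (shiftComp t : CoordSpace p q N →ₗ[ℝ] Gr N) :=
      (LinearMap.toContinuousLinearMap (shiftComp t)).contDiff
    have h3' : ∀ u : CoordSpace p q N, fderiv ℝ (shiftComp t : CoordSpace p q N →ₗ[ℝ] Gr N) u =
        LinearMap.toContinuousLinearMap (shiftComp t) := fun u =>
      (LinearMap.toContinuousLinearMap (shiftComp t)).hasFDerivAt.fderiv
    rw [heq]
    refine ⟨h1.add (contDiff_gr_mul h3 h2), fun u v => ?_⟩
    rw [fderiv_fun_add (h1.differentiable (by simp) u)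
      ((contDiff_gr_mul h3 h2).differentiable (by simp) u), add_apply,
      fderiv_gr_mul h3 h2, h1', h2', h3']
    change _ + (_ + shiftComp t v * _) = _
    have hcomm : ∀ b : Gr N, shiftComp t u * b = b * shiftComp t u := fun b => by
      rw [shiftComp_apply]; exact ((monomialShift _ t.2).comm b).eq
    -- Expanding the formula for the longer list: the shift of `u` is central and moves to the
    -- front, the partial derivatives commute, and the cross term of the shifts of `u` and `v`
    -- vanishes.
    have hsum : ∀ i, partialCoord (t :: l) i v * evalList u (t :: l) (SmoothFun.partialDeriv i f) =
        partialCoord l i v * evalList u l (SmoothFun.partialDeriv i f) +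
        shiftComp t u * (partialCoord l i v *
          evalList u l (SmoothFun.partialDeriv i (SmoothFun.partialDeriv t.1 f))) +
        if t.1 = i then shiftComp t v * evalList u l (SmoothFun.partialDeriv t.1 f) else 0 := by
      intro i
      have hp : partialCoord (t :: l) i v = partialCoord l i v +
          if t.1 = i then shiftComp t v else 0 := by
        simp only [partialCoord, List.map_cons, List.sum_cons]; abel
      have h0 : partialCoord l i v * (shiftComp t u *
          evalList u l (SmoothFun.partialDeriv t.1 (SmoothFun.partialDeriv i f))) =
          shiftComp t u * (partialCoord l i v *
          evalList u l (SmoothFun.partialDeriv i (SmoothFun.partialDeriv t.1 f))) := by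
        rw [← mul_assoc, ← hcomm, mul_assoc, SmoothFun.partialDeriv_comm]
      rw [hp, evalList_cons, add_mul, mul_add, h0]
      split_ifs with hi
      · subst hi
        rw [mul_add, ← mul_assoc (shiftComp t v), shiftComp_mul_shiftComp, zero_mul, add_zero]
      · rw [zero_mul]
    rw [Finset.sum_congr rfl fun i _ => hsum i, Finset.sum_add_distrib, Finset.sum_add_distrib,
      ← Finset.mul_sum, Finset.sum_ite_eq, if_pos (Finset.mem_univ _), add_assoc]

/-- For the full list of monomials `partialCoord` is the coordinate itself, so the differential is v
↦ ∑ v_i · (∂_i f)(u). -/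
lemma evenSmooth_evalSmooth (f : SmoothFun p ⊤) :
    EvenSmooth fun u : CoordSpace p q N => evalSmooth u f := by
  obtain ⟨h1, h2⟩ := evalList_smooth (q := q)
    (Finset.univ : Finset (Fin p × Finset (Fin N))).toList f
  have hp : ∀ i (v : CoordSpace p q N), partialCoord
      (Finset.univ : Finset (Fin p × Finset (Fin N))).toList i v = v.1 i := by
    intro i v
    rw [partialCoord, sum_toList_prod (fun t => shiftComp t v) i]
    simp only [shiftComp_apply]
    rw [sum_monomialShift (v.1 i).2]
    exact body_add_nil (v.1 i : Gr N)
  refine ⟨h1, fun u v c => ?_⟩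
  change fderiv ℝ (fun u : CoordSpace p q N => evalList u _ f) u _ =
    _ * fderiv ℝ (fun u : CoordSpace p q N => evalList u _ f) u _
  rw [h2, h2, Finset.mul_sum]
  refine Finset.sum_congr rfl fun i _ => ?_
  rw [hp, hp, ← mul_assoc]
  rfl

lemma evenSmooth_toPoint (s : Sections p q ⊤) :
    EvenSmooth fun u : CoordSpace p q N => toPoint u s := by
  induction s using TensorProduct.induction_on with
  | zero => simpa using EvenSmooth.const 0
  | add x y hx hy => simpa using hx.add hy
  | tmul f b =>
    have h1 : EvenSmooth fun u : CoordSpace p q N => toPoint u (f ⊗ₜ 1) := by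
      simpa only [toPoint_tmul_one] using evenSmooth_evalSmooth f
    have h2 : EvenSmooth fun u : CoordSpace p q N => toPoint u (1 ⊗ₜ b) := by
      induction b using ExteriorAlgebra.induction with
      | algebraMap r =>
        have : ∀ u : CoordSpace p q N, toPoint u (1 ⊗ₜ algebraMap ℝ _ r) = algebraMap ℝ _ r :=
          fun u => AlgHom.commutes ((toPoint u).toAlgHom.comp Algebra.TensorProduct.includeRight) r
        simpa only [this] using EvenSmooth.const _
      | ι v =>
        have : ∀ u : CoordSpace p q N, toPoint u (1 ⊗ₜ ExteriorAlgebra.ι ℝ v) =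
            (∑ j, v j • projOdd j : CoordSpace p q N →ₗ[ℝ] Gr N) u := fun u => by
          rw [ι_eq_sum, TensorProduct.tmul_sum, map_sum]
          simp only [TensorProduct.tmul_smul, map_smul, toPoint_one_tmul_gen, LinearMap.sum_apply,
            LinearMap.smul_apply, projOdd_apply]
        simp only [this]
        refine EvenSmooth.of_linear _ fun c w => ?_
        simp only [LinearMap.sum_apply, LinearMap.smul_apply, Finset.mul_sum, mul_smul_comm]
        rfl
      | mul x y hx hy =>
        have : ∀ u : CoordSpace p q N, toPoint u (1 ⊗ₜ (x * y)) =
            toPoint u (1 ⊗ₜ x) * toPoint u (1 ⊗ₜ y) := fun u => by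
          rw [← map_mul, Algebra.TensorProduct.tmul_mul_tmul, one_mul]
        simpa only [this] using hx.mul hy
      | add x y hx hy =>
        simpa only [TensorProduct.tmul_add, map_add] using hx.add hy
    have : ∀ u : CoordSpace p q N, toPoint u (f ⊗ₜ b) =
        toPoint u (f ⊗ₜ 1) * toPoint u (1 ⊗ₜ b) := fun u => by
      rw [← map_mul, Algebra.TensorProduct.tmul_mul_tmul, one_mul, mul_one]
    simpa only [this] using h1.mul h2

/-- `Λ_0`-smoothness can be checked on the coordinates. -/
lemma isEvenSmooth_iff (α : points p q ⟶ points m n) (A : GrassmannAlg) :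
    IsEvenSmooth (fun x : (points p q).obj A => α.app A x) ↔
      (∀ k, EvenSmooth fun u => ((coordMap α A.gens u).1 k : Gr A.gens)) ∧
      ∀ l, EvenSmooth fun u => ((coordMap α A.gens u).2 l : Gr A.gens) := by
  have hproj : ∀ (P : CoordSpace m n A.gens →ₗ[ℝ] Gr A.gens)
      {f : CoordSpace p q A.gens → CoordSpace m n A.gens} (hf : ContDiff ℝ ∞ f)
      (u v : CoordSpace p q A.gens),
      fderiv ℝ (fun u => P (f u)) u v = P (fderiv ℝ f u v) := fun P f hf u v => by
    have : HasFDerivAt (fun u => P (f u)) ((LinearMap.toContinuousLinearMap P).comp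
        (fderiv ℝ f u)) u :=
      (LinearMap.toContinuousLinearMap P).hasFDerivAt.comp u
        (hf.differentiable (by simp) u).hasFDerivAt
    rw [this.fderiv]; rfl
  constructor
  · rintro ⟨f, hf, hs, hl⟩
    have hfeq : coordMap α A.gens = f := funext fun u => by
      rw [← coords_ofCoords u, ← coords_app, hf]
    have h : ∀ P : CoordSpace m n A.gens →ₗ[ℝ] Gr A.gens,
        (∀ (c : Gr.parity A.gens 0) v, P (evenSMul c v) = c.1 * P v) →
        EvenSmooth fun u => P (coordMap α A.gens u) := fun P hP => by
      rw [hfeq]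
      refine ⟨(LinearMap.toContinuousLinearMap P).contDiff.comp hs, fun u v c => ?_⟩
      rw [hproj P hs, hproj P hs, hl, hP]
    exact ⟨fun k => h (projEven k) fun _ _ => rfl, fun l => h (projOdd l) fun _ _ => rfl⟩
  · rintro ⟨h0, h1⟩
    let P : CoordSpace m n A.gens →ₗ[ℝ] (Fin m → Gr A.gens) × (Fin n → Gr A.gens) :=
      (LinearMap.pi projEven).prod (LinearMap.pi projOdd)
    have hP : LinearMap.ker P = ⊥ := by
      rw [LinearMap.ker_eq_bot]
      intro u v huv
      ext k
      · exact congrFun (congrArg Prod.fst huv) k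
      · exact congrFun (congrArg Prod.snd huv) k
    -- A linear retraction onto Λ_0^m × Λ_1^n turns smoothness of the Λ-valued components into
    -- smoothness of the map itself.
    obtain ⟨Q, hQ⟩ := LinearMap.exists_leftInverse_of_injective P hP
    have hs : ContDiff ℝ ∞ (coordMap α A.gens) := by
      have h : ContDiff ℝ ∞ fun u => P (coordMap α A.gens u) :=
        (contDiff_pi.mpr fun k => (h0 k).1).prodMk (contDiff_pi.mpr fun l => (h1 l).1)
      have hQ' : (fun u => Q (P (coordMap α A.gens u))) = coordMap α A.gens :=
        funext fun u => LinearMap.congr_fun hQ _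
      rw [← hQ']
      exact (LinearMap.toContinuousLinearMap Q).contDiff.comp h
    refine ⟨coordMap α A.gens, coords_app α, hs, fun u v c => ?_⟩
    ext k
    · have := (h0 k).2 u v c
      have e := hproj (projEven k) hs u
      simp only [projEven_apply] at e
      rw [e, e] at this
      exact this
    · have := (h1 k).2 u v c
      have e := hproj (projOdd k) hs u
      simp only [projOdd_apply] at e
      rw [e, e] at this
      exact this

lemma coordMap_toNatTrans_fst (φ : Morphism p q m n) (u : CoordSpace p q N) (k : Fin m) :
    ((coordMap φ.toNatTrans N u).1 k : Gr N) = toPoint u (φ.globalPullback (evenCoord m n k)) := rfl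

lemma coordMap_toNatTrans_snd (φ : Morphism p q m n) (u : CoordSpace p q N) (l : Fin n) :
    ((coordMap φ.toNatTrans N u).2 l : Gr N) = toPoint u (φ.globalPullback (oddCoord m n l)) := rfl

/-- Natural transformations given by morphisms of supermanifolds are `Λ_0`-smooth. -/
lemma Morphism.isEvenSmooth_toNatTrans (φ : Morphism p q m n) (A : GrassmannAlg) :
    IsEvenSmooth (fun x : (points p q).obj A => φ.toNatTrans.app A x) := by
  rw [isEvenSmooth_iff]
  exact ⟨fun k => evenSmooth_toPoint (φ.globalPullback (evenCoord m n k)),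
    fun l => evenSmooth_toPoint (φ.globalPullback (oddCoord m n l))⟩

end
end Super

namespace Super

open Gr CoordSpace

/-! ### Natural smooth functions that vanish at real points -/

section

attribute [local instance] Gr.normedAddCommGroup Gr.normedSpace

lemma CoordSpace.evenSMul_evenDir {p q N : ℕ} (c w : Gr.parity N 0) (i : Fin p) :
    evenSMul c (evenDir i w : CoordSpace p q N) =
      evenDir i ⟨c.1 * w.1, even_mul_mem c.2 w.2⟩ := by
  ext k
  · change c.1 * ((evenDir i w : CoordSpace p q N).1 k : Gr N) = _
    simp
  · change c.1 * ((evenDir i w : CoordSpace p q N).2 k : Gr N) = _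
    simp

/-- Multiplication by η₁η₂ is injective on Λ_N, so it has a linear left inverse. This is continuous
in finite dimension and carries the derivative back. -/
lemma hasDerivAt_of_eta_mul {N : ℕ} {f : ℝ → Gr N} {a : Gr N} {t : ℝ}
    (h : HasDerivAt (fun t => (eta₁ N * eta₂ N : Gr (N + 2)) * incl N (f t))
      (eta₁ N * eta₂ N * incl N a) t) : HasDerivAt f a t := by
  let P : Gr N →ₗ[ℝ] Gr (N + 2) :=
    LinearMap.mulLeft ℝ (eta₁ N * eta₂ N : Gr (N + 2)) ∘ₗ (incl N).toAlgHom.toLinearMap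
  obtain ⟨Q, hQ⟩ := LinearMap.exists_leftInverse_of_injective P
    (LinearMap.ker_eq_bot'.mpr fun b hb => eq_zero_of_eta_mul hb)
  have h' := (LinearMap.toContinuousLinearMap Q).hasFDerivAt.comp_hasDerivAt t h
  have h1 : ∀ b, Q (eta₁ N * eta₂ N * incl N b) = b := fun b => LinearMap.congr_fun hQ b
  change HasDerivAt (fun t => Q (eta₁ N * eta₂ N * incl N (f t)))
    (Q (eta₁ N * eta₂ N * incl N a)) t at h'
  simpa only [h1] using h'

namespace NatFun

variable {p q : ℕ}

/-- The algebraic derivatives of `g` are derivatives in the real even directions. -/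
def HasRealDerivs (g : NatFun p q) : Prop :=
  ∀ (N : ℕ) (u : CoordSpace p q N) (i : Fin p),
    HasDerivAt (fun t : ℝ => g.1 N (u + t • evenDir i ⟨1, one_mem_even⟩)) ((deriv i g).1 N u) 0

lemma incl_apply_add (g : NatFun p q) {N : ℕ} (u : CoordSpace p q N) (i : Fin p) (t : ℝ) :
    incl N (g.1 N (u + t • evenDir i ⟨1, one_mem_even⟩)) =
      g.1 (N + 2) (map (incl N) u + t • evenDir i ⟨1, one_mem_even⟩) := by
  rw [← map_apply, map_add, map_smul, map_evenDir,
    show mapPart (incl N) 0 ⟨1, one_mem_even⟩ = ⟨1, one_mem_even⟩ from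
      Subtype.ext (map_one (incl N))]

/-- Along η₁η₂ e_i the function is affine with slope η₁η₂ · ∂_i g, while Λ_0-linearity of the
differential makes the slope η₁η₂ · dg(e_i). Cancelling η₁η₂ identifies the algebraic with the real
derivative. -/
lemma hasRealDerivs_of_evenSmooth {g : NatFun p q} (hg : ∀ N, EvenSmooth (g.1 N)) :
    HasRealDerivs g := by
  intro N u i
  refine hasDerivAt_of_eta_mul ?_
  set u' := map (incl N) u
  have hline : ∀ v : CoordSpace p q (N + 2), HasDerivAt (fun t : ℝ => g.1 (N + 2) (u' + t • v))
      (fderiv ℝ (g.1 (N + 2)) u' v) 0 := fun v => by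
    have h1 : HasDerivAt (fun t : ℝ => u' + t • v) v 0 := by
      simpa using ((hasDerivAt_id (0 : ℝ)).smul_const v).const_add u'
    have h2 : HasFDerivAt (g.1 (N + 2)) (fderiv ℝ (g.1 (N + 2)) u') (u' + (0 : ℝ) • v) := by
      rw [zero_smul, add_zero]
      exact ((hg (N + 2)).1.differentiable (by simp) u').hasFDerivAt
    exact h2.comp_hasDerivAt 0 h1
  let E : Gr.parity (N + 2) 0 := oddMul (eta₁ N) (eta₂ N)
  have hE : fderiv ℝ (g.1 (N + 2)) u' (evenDir i E) =
      E.1 * fderiv ℝ (g.1 (N + 2)) u' (evenDir i ⟨1, one_mem_even⟩) := by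
    rw [← (hg (N + 2)).2, evenSMul_evenDir]
    congr 2
    exact Subtype.ext (mul_one _).symm
  have hE' : HasDerivAt (fun t : ℝ => g.1 (N + 2) (u' + t • evenDir i E))
      (E.1 * incl N ((deriv i g).1 N u)) 0 := by
    -- The real parameter is absorbed into the first odd factor, so the algebraic expansion holds
    -- exactly for every t.
    have h1 : (fun t : ℝ => g.1 (N + 2) (u' + t • evenDir i E)) = fun t : ℝ =>
        g.1 (N + 2) u' + t • (E.1 * incl N ((deriv i g).1 N u)) := funext fun t => by
      have := isDeriv_deriv i g _ u' (t • eta₁ N) (eta₂ N)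
      rw [show (deriv i g).1 _ u' = incl N ((deriv i g).1 N u) from map_apply _ _ _] at this
      rw [← map_smul, show t • E = oddMul (t • eta₁ N) (eta₂ N) from
        Subtype.ext (smul_mul_assoc _ _ _).symm, this, Submodule.coe_smul, smul_mul_assoc,
        smul_mul_assoc]
      rfl
    rw [h1]
    simpa using ((hasDerivAt_id (0 : ℝ)).smul_const
      (E.1 * incl N ((deriv i g).1 N u))).const_add (g.1 (N + 2) u')
  have h2 := (hline (evenDir i E)).unique hE'
  rw [hE] at h2
  change HasDerivAt _ (E.1 * incl N ((deriv i g).1 N u)) 0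
  rw [← h2]
  simp only [incl_apply_add]
  exact (Gr.mulL (N + 2) E.1).hasFDerivAt.comp_hasDerivAt 0 (hline _)

/-- After multiplication by η₁η₂, ∂_j g is a difference of two values of g, which can be
differentiated in the direction e_i; then ∂_i and ∂_j are exchanged. The induction thus never needs
∂_j g to be Λ_0-smooth. -/
lemma HasRealDerivs.natFunDeriv {g : NatFun p q} (hg : HasRealDerivs g) (j : Fin p) :
    HasRealDerivs (NatFun.deriv j g) := by
  intro N u i
  refine hasDerivAt_of_eta_mul ?_
  let E : Gr.parity (N + 2) 0 := oddMul (eta₁ N) (eta₂ N)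
  have h1 : ∀ v : CoordSpace p q (N + 2), E.1 * (NatFun.deriv j g).1 (N + 2) v =
      g.1 (N + 2) (v + evenDir j E) - g.1 (N + 2) v := fun v => by
    rw [isDeriv_deriv j g _ v (eta₁ N) (eta₂ N), add_sub_cancel_left]; rfl
  have h2 : E.1 * incl N ((NatFun.deriv i (NatFun.deriv j g)).1 N u) =
      (NatFun.deriv i g).1 (N + 2) (map (incl N) u + evenDir j E) -
        (NatFun.deriv i g).1 (N + 2) (map (incl N) u) := by
    rw [deriv_comm, isDeriv_deriv j (NatFun.deriv i g) _ _ (eta₁ N) (eta₂ N), add_sub_cancel_left,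
      map_apply]; rfl
  have h4 : (fun t : ℝ => (eta₁ N * eta₂ N : Gr (N + 2)) * incl N ((NatFun.deriv j g).1 N
      (u + t • evenDir i ⟨1, one_mem_even⟩))) = fun t =>
      g.1 (N + 2) (map (incl N) u + t • evenDir i ⟨1, one_mem_even⟩ + evenDir j E) -
        g.1 (N + 2) (map (incl N) u + t • evenDir i ⟨1, one_mem_even⟩) := funext fun t => by
    rw [incl_apply_add]
    exact h1 _
  rw [h4]
  refine HasDerivAt.congr_deriv ?_ h2.symm
  have h3 := hg _ (map (incl N) u + evenDir j E) i
  simp only [add_right_comm _ (evenDir j E)] at h3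
  exact h3.sub (hg _ _ i)

/-- Real even directions lead from generic points to generic points, so the derivative there is that
of the zero function. -/
lemma HasRealDerivs.deriv_apply_ofReal {g : NatFun p q} (hg : HasRealDerivs g)
    (h0 : ∀ a, g.1 q (ofReal a (gens q)) = 0) (i : Fin p) (a : Fin p → ℝ) :
    (NatFun.deriv i g).1 q (ofReal a (gens q)) = 0 := by
  refine (hg q (ofReal a (gens q)) i).unique ?_
  have : ∀ t : ℝ, (ofReal a (gens q) : CoordSpace p q q) + t • evenDir i ⟨1, one_mem_even⟩ =
      ofReal (a + t • Pi.single i 1) (gens q) := fun t => by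
    ext k
    · by_cases h : k = i
      · subst h; simp [Algebra.algebraMap_eq_smul_one, evenDir, add_smul]
      · simp [evenDir, h]
    · simp
  simp only [this, h0]
  exact hasDerivAt_const _ _

/-- A natural `Λ_0`-smooth function is zero if it vanishes at the points with real even
coordinates. -/
lemma eq_zero_of_evenSmooth {g : NatFun p q} (hg : ∀ N, EvenSmooth (g.1 N))
    (h0 : ∀ a, g.1 q (ofReal a (gens q)) = 0) : g = 0 := by
  refine eq_zero_of_iterDeriv g fun s => ?_
  have : HasRealDerivs (iterDeriv s g) ∧ ∀ a, (iterDeriv s g).1 q (ofReal a (gens q)) = 0 := by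
    induction s using Multiset.induction_on with
    | empty => exact ⟨hasRealDerivs_of_evenSmooth hg, h0⟩
    | cons i s ih =>
      rw [iterDeriv_cons]
      exact ⟨ih.1.natFunDeriv i, ih.1.deriv_apply_ofReal ih.2 i⟩
  exact this.2

end NatFun

end
end Super

namespace Super

open Gr CoordSpace

/-! ### Sections form a supercommutative algebra -/

namespace Sections

variable {p q : ℕ} {U V : Opens (Fin p → ℝ)}

lemma commute_of_even {x : Sections p q U} (hx : x ∈ Sections.parity p q U 0)
    (y : Sections p q U) : Commute x y := by
  change x ∈ (Gr.parity q 0).baseChange (SmoothFun p U) at hx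
  rw [Submodule.baseChange_eq_span] at hx
  induction hx using Submodule.span_induction with
  | mem x hx =>
    obtain ⟨a, ha, rfl⟩ := hx
    induction y using TensorProduct.induction_on with
    | zero => exact Commute.zero_right _
    | add y z hy hz => exact hy.add_right hz
    | tmul f b =>
      change (1 ⊗ₜ a : Sections p q U) * (f ⊗ₜ b) = (f ⊗ₜ b) * (1 ⊗ₜ a)
      rw [Algebra.TensorProduct.tmul_mul_tmul, Algebra.TensorProduct.tmul_mul_tmul, one_mul, mul_one,
        (Gr.commute_of_even ha b).eq]
  | zero => exact Commute.zero_left _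
  | add x z _ _ hx hz => exact hx.add_left hz
  | smul c x _ hx => exact hx.smul_left c

/-- The bilinear form of a² = 0 is proved first because, unlike the square, it extends from pure
tensors to their span. -/
lemma add_swap_of_odd {x y : Sections p q U} (hx : x ∈ Sections.parity p q U 1)
    (hy : y ∈ Sections.parity p q U 1) : x * y + y * x = 0 := by
  change x ∈ (Gr.parity q 1).baseChange (SmoothFun p U) at hx
  change y ∈ (Gr.parity q 1).baseChange (SmoothFun p U) at hy
  rw [Submodule.baseChange_eq_span] at hx hy
  induction hx, hy using Submodule.span_induction₂ with
  | mem_mem x y hx hy =>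
    obtain ⟨a, ha, rfl⟩ := hx
    obtain ⟨b, hb, rfl⟩ := hy
    change (1 ⊗ₜ a : Sections p q U) * (1 ⊗ₜ b) + (1 ⊗ₜ b) * (1 ⊗ₜ a) = 0
    rw [Algebra.TensorProduct.tmul_mul_tmul, Algebra.TensorProduct.tmul_mul_tmul,
      ← TensorProduct.tmul_add, (superComm q).anticomm ha hb, neg_add_cancel, TensorProduct.tmul_zero]
  | zero_left y _ => rw [zero_mul, mul_zero, add_zero]
  | zero_right x _ => rw [zero_mul, mul_zero, add_zero]
  | add_left x y z _ _ _ h h' => rw [add_mul, mul_add, add_add_add_comm, h, h', add_zero]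
  | add_right x y z _ _ _ h h' => rw [add_mul, mul_add, add_add_add_comm, h, h', add_zero]
  | smul_left c x y _ _ h => rw [smul_mul_assoc, mul_smul_comm, ← smul_add, h, smul_zero]
  | smul_right c x y _ _ h => rw [smul_mul_assoc, mul_smul_comm, ← smul_add, h, smul_zero]

lemma superComm (p q : ℕ) (U : Opens (Fin p → ℝ)) : SuperComm (Sections.parity p q U) where
  comm := commute_of_even
  sq hx := by
    have h := add_swap_of_odd hx hx
    rw [← two_smul ℝ] at h
    exact (smul_eq_zero.mp h).resolve_left two_ne_zero

@[simp] lemma restrict_tmul (h : U ≤ V) (f : SmoothFun p V) (b : Gr q) :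
    Sections.restrict p q h (f ⊗ₜ b) = SmoothFun.restrict h f ⊗ₜ b := rfl

lemma tmul_mem {i : ZMod 2} (f : SmoothFun p U) {b : Gr q} (hb : b ∈ Gr.parity q i) :
    f ⊗ₜ b ∈ Sections.parity p q U i := Submodule.tmul_mem_baseChange_of_mem _ hb

lemma value_of_odd (x : U) {s : Sections p q U} (hs : s ∈ Sections.parity p q U 1) :
    Sections.value p q x s = 0 := by
  rw [← mul_self_eq_zero, ← map_mul, (superComm p q U).sq hs, map_zero]

/-- The generic point (a, θ) evaluates the coefficients at a and leaves the θ_j alone, so it reads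
off a section as a function of a with values in Λ_q. -/
lemma toPoint_ofReal_gens_restrict (h : ⊤ ≤ U) (a : Fin p → ℝ) (f : SmoothFun p U) (b : Gr q) :
    toPoint (ofReal a (gens q)) (Sections.restrict p q h (f ⊗ₜ b)) =
      SmoothFun.eval ⟨a, h trivial⟩ f • b := by
  have h1 : evalSmooth (ofReal a (gens q)) = (Algebra.ofId ℝ (Gr q)).comp
      (SmoothFun.eval (⟨a, trivial⟩ : (⊤ : Opens (Fin p → ℝ)))) :=
    SmoothFun.algHom_ext fun i => evalSmooth_coord _ _
  have h2 : (toPoint (ofReal a (gens q))).toAlgHom.comp Algebra.TensorProduct.includeRight =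
      AlgHom.id ℝ (Gr q) := Gr.algHom_ext fun j => toPoint_one_tmul_gen _ _
  have h3 : toPoint (ofReal a (gens q)) (1 ⊗ₜ b) = b := DFunLike.congr_fun h2 b
  rw [restrict_tmul, ← mul_one (SmoothFun.restrict h f), ← one_mul b,
    ← Algebra.TensorProduct.tmul_mul_tmul, map_mul, toPoint_tmul_one, h1, h3, one_mul,
    Algebra.smul_def]
  rfl

/-- The product of a smooth function and a central element of square zero. -/
def centralTmul (f : SmoothFun p U) (w : CentralSqZero (Gr q)) : CentralSqZero (Sections p q U) :=
  ⟨f ⊗ₜ w.val, by rw [Algebra.TensorProduct.tmul_mul_tmul, w.sq, TensorProduct.tmul_zero],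
    fun s => by
      induction s using TensorProduct.induction_on with
      | zero => exact Commute.zero_right _
      | add y z hy hz => exact hy.add_right hz
      | tmul g b =>
        change (f ⊗ₜ w.val : Sections p q U) * (g ⊗ₜ b) = (g ⊗ₜ b) * (f ⊗ₜ w.val)
        rw [Algebra.TensorProduct.tmul_mul_tmul, Algebra.TensorProduct.tmul_mul_tmul, mul_comm f,
          (w.comm b).eq]⟩

end Sections

lemma map_shiftList {C C' R R' ι τ : Type*} [CommRing C] [Algebra ℝ C] [Ring R] [Algebra ℝ R]
    [CommRing C'] [Algebra ℝ C'] [Ring R'] [Algebra ℝ R']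
    {D : ι → Derivation ℝ C C} {D' : ι → Derivation ℝ C' C'} {E : C →ₐ[ℝ] R} {E' : C' →ₐ[ℝ] R'}
    (r : C →ₐ[ℝ] C') (ρ : R →ₐ[ℝ] R') (hE : ∀ f, ρ (E f) = E' (r f))
    (hD : ∀ i f, r (D i f) = D' i (r f)) (l : List τ) (i : τ → ι) (w : τ → CentralSqZero R)
    (w' : τ → CentralSqZero R') (hw : ∀ t, ρ (w t).val = (w' t).val) (f : C) :
    ρ (shiftList D E (l.map fun t => (i t, w t)) f) =
      shiftList D' E' (l.map fun t => (i t, w' t)) (r f) := by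
  induction l generalizing f with
  | nil => exact hE f
  | cons t l ih =>
    rw [List.map_cons, List.map_cons, shiftList_cons, shiftList_cons, map_add, map_mul,
      hw, ih, ih, hD]

namespace SmoothFun

variable {p m : ℕ}

/-- The pullback of smooth functions along a smooth map. -/
def comp (β : C(Fin p → ℝ, Fin m → ℝ)) (hβ : ContDiff ℝ ∞ β) (V : Opens (Fin m → ℝ)) :
    SmoothFun m V →ₐ[ℝ] SmoothFun p (Opens.comap β V) where
  toFun f := ofContDiffOn (fun x => f.ambient (β x))
    (f.contDiffOn_ambient.comp hβ.contDiffOn fun _ hx => hx)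
  map_one' := ext_eval fun x => ambient_apply (1 : SmoothFun m V) ⟨β x.1, x.2⟩
  map_mul' f g := ext_eval fun x => by
    rw [map_mul]
    simp only [eval_ofContDiffOn]
    rw [ambient_apply _ (⟨β x.1, x.2⟩ : V), ambient_apply _ (⟨β x.1, x.2⟩ : V),
      ambient_apply _ (⟨β x.1, x.2⟩ : V), map_mul]
  map_zero' := ext_eval fun x => ambient_apply (0 : SmoothFun m V) ⟨β x.1, x.2⟩
  map_add' f g := ext_eval fun x => by
    rw [map_add]
    simp only [eval_ofContDiffOn]
    rw [ambient_apply _ (⟨β x.1, x.2⟩ : V), ambient_apply _ (⟨β x.1, x.2⟩ : V),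
      ambient_apply _ (⟨β x.1, x.2⟩ : V), map_add]
  commutes' r := ext_eval fun x => ambient_apply (algebraMap ℝ (SmoothFun m V) r) ⟨β x.1, x.2⟩

lemma eval_comp (β : C(Fin p → ℝ, Fin m → ℝ)) (hβ : ContDiff ℝ ∞ β) (V : Opens (Fin m → ℝ))
    (f : SmoothFun m V) (x : Opens.comap β V) :
    eval x (comp β hβ V f) = eval ⟨β x.1, x.2⟩ f := ambient_apply f ⟨β x.1, x.2⟩

end SmoothFun

/-! ### The morphism with given smooth coordinates -/

/-- Functions `ℝ^p → Λ_q` with smooth coefficients that are the coordinates of a morphism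
`ℝ^{p|q} → ℝ^{m|n}`. -/
structure MorphismData (p q m n : ℕ) where
  /-- the even coordinates -/
  even : Fin m → (Fin p → ℝ) → Gr q
  /-- the odd coordinates -/
  odd : Fin n → (Fin p → ℝ) → Gr q
  even_mem : ∀ k a, even k a ∈ Gr.parity q 0
  odd_mem : ∀ l a, odd l a ∈ Gr.parity q 1
  contDiff_even : ∀ k S, ContDiff ℝ ∞ fun a => (monomialBasis q).repr (even k a) S
  contDiff_odd : ∀ l S, ContDiff ℝ ∞ fun a => (monomialBasis q).repr (odd l a) S

namespace MorphismData

variable {p q m n : ℕ} (Φ : MorphismData p q m n)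

lemma contDiff_body : ContDiff ℝ ∞ fun a k => Gr.body (Φ.even k a) := by
  rw [contDiff_pi]
  intro k
  simpa only [body_eq_repr] using Φ.contDiff_even k ∅

/-- The underlying map. -/
def base : C(Fin p → ℝ, Fin m → ℝ) := ⟨fun a k => Gr.body (Φ.even k a), Φ.contDiff_body.continuous⟩

lemma contDiff_base : ContDiff ℝ ∞ Φ.base := Φ.contDiff_body

/-- The components of the even coordinates in monomials of positive degree. -/
def evenShift (U : Opens (Fin p → ℝ)) (t : Fin m × Finset (Fin q)) :
    CentralSqZero (Sections p q U) :=
  Sections.centralTmul (SmoothFun.ofContDiffOn _ (Φ.contDiff_even t.1 t.2).contDiffOn)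
    (monomialShift 1 t.2)

/-- The sections given by the odd coordinates. -/
def oddSection (U : Opens (Fin p → ℝ)) (l : Fin n) : Sections p q U :=
  ∑ S, SmoothFun.ofContDiffOn _ (Φ.contDiff_odd l S).contDiffOn ⊗ₜ monomialBasis q S

lemma oddSection_mem (U : Opens (Fin p → ℝ)) (l : Fin n) :
    Φ.oddSection U l ∈ Sections.parity p q U 1 := by
  refine sum_mem fun S _ => ?_
  by_cases hS : (S.card : ZMod 2) = 1
  · exact Sections.tmul_mem _ (hS ▸ monomialBasis_mem S)
  · have : SmoothFun.ofContDiffOn _ (Φ.contDiff_odd l S).contDiffOn = (0 : SmoothFun p U) :=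
      SmoothFun.ext_eval fun x => repr_eq_zero_of_mem (Φ.odd_mem l x.1) hS
    rw [this, TensorProduct.zero_tmul]
    exact zero_mem _

/-- The pullback of smooth functions. -/
def pullbackSmooth (V : Opens (Fin m → ℝ)) :
    SmoothFun m V →ₐ[ℝ] Sections p q (Opens.comap Φ.base V) :=
  -- Taylor's formula around the underlying map: the nilpotent part of the even coordinates is added
  -- one monomial at a time, now with smooth coefficients.
  shiftList SmoothFun.partialDeriv
    (Algebra.TensorProduct.includeLeft.comp (SmoothFun.comp Φ.base Φ.contDiff_base V))
    (Finset.univ.toList.map fun t : Fin m × Finset (Fin q) => (t.1, Φ.evenShift _ t))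

lemma pullbackSmooth_mem (V : Opens (Fin m → ℝ)) (f : SmoothFun m V) :
    Φ.pullbackSmooth V f ∈ Sections.parity p q (Opens.comap Φ.base V) 0 := by
  refine shiftList_mem _ (fun f => Sections.tmul_mem _ one_mem_even) (fun t ht => ?_) f
  obtain ⟨s, -, rfl⟩ := List.mem_map.mp ht
  exact Sections.tmul_mem _ (monomialShift_mem _ _)

/-- The pullback of sections. -/
def pullback (V : Opens (Fin m → ℝ)) :
    GradedAlgHom ℝ (Sections.parity m n V) (Sections.parity p q (Opens.comap Φ.base V)) :=
  Sections.lift (Sections.superComm p q _) (Φ.pullbackSmooth V) (Φ.pullbackSmooth_mem V)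
    fun l => ⟨Φ.oddSection _ l, Φ.oddSection_mem _ l⟩

lemma pullback_tmul_one (V : Opens (Fin m → ℝ)) (f : SmoothFun m V) :
    Φ.pullback V (f ⊗ₜ 1) = Φ.pullbackSmooth V f := Sections.lift_tmul_one _ _ _ _ _

lemma pullback_one_tmul_gen (V : Opens (Fin m → ℝ)) (l : Fin n) :
    Φ.pullback V (1 ⊗ₜ gen l) = Φ.oddSection _ l := Sections.lift_one_tmul_gen _ _ _ _ _

lemma pullback_restrict {W V : Opens (Fin m → ℝ)} (h : W ≤ V) (s : Sections m n V) :
    Φ.pullback W (Sections.restrict m n h s) =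
      Sections.restrict p q (Opens.comap_mono Φ.base h) (Φ.pullback V s) := by
  have : (Φ.pullback W).toAlgHom.comp (Sections.restrict m n h).toAlgHom =
      (Sections.restrict p q (Opens.comap_mono Φ.base h)).toAlgHom.comp (Φ.pullback V).toAlgHom := by
    refine Sections.algHom_ext (fun f => ?_) fun l => ?_
    · change Φ.pullback W (SmoothFun.restrict h f ⊗ₜ 1) = Sections.restrict p q _ (Φ.pullback V _)
      rw [pullback_tmul_one, pullback_tmul_one]
      refine (map_shiftList (SmoothFun.restrict h)
        (Sections.restrict p q (Opens.comap_mono Φ.base h)).toAlgHom (fun f => ?_)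
        (fun i f => (SmoothFun.partialDeriv_restrict h i f).symm) _ _ _ _ (fun t => rfl) f).symm
      change SmoothFun.restrict _ (SmoothFun.comp _ Φ.contDiff_base _ f) ⊗ₜ 1 =
        SmoothFun.comp _ Φ.contDiff_base _ _ ⊗ₜ 1
      congr 1
      refine SmoothFun.ext_eval fun x => ?_
      rw [SmoothFun.eval_restrict, SmoothFun.eval_comp, SmoothFun.eval_comp, SmoothFun.eval_restrict]
    · change Φ.pullback W (SmoothFun.restrict h 1 ⊗ₜ gen l) =
        Sections.restrict p q _ (Φ.pullback V (1 ⊗ₜ gen l))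
      rw [map_one, pullback_one_tmul_gen, pullback_one_tmul_gen, oddSection, oddSection, map_sum]
      rfl
  exact DFunLike.congr_fun this s

/-- The shifts and the odd sections have value zero at every point, so only composition with the
underlying map is visible. Locality on stalks follows. -/
lemma value_pullback {V : Opens (Fin m → ℝ)} (x : Opens.comap Φ.base V) (s : Sections m n V) :
    Sections.value p q x (Φ.pullback V s) =
      Sections.value m n (⟨Φ.base x.1, x.2⟩ : V) s := by
  have : (Sections.value p q x).comp (Φ.pullback V).toAlgHom =
      Sections.value m n (⟨Φ.base x.1, x.2⟩ : V) := by
    refine Sections.algHom_ext (fun f => ?_) fun l => ?_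
    · change Sections.value p q x (Φ.pullback V (f ⊗ₜ 1)) = _
      rw [pullback_tmul_one, pullbackSmooth, comp_shiftList_eq]
      · change SmoothFun.eval x (SmoothFun.comp _ Φ.contDiff_base _ f) * Gr.body 1 =
          SmoothFun.eval _ f * Gr.body 1
        rw [SmoothFun.eval_comp, map_one, map_one]
      · intro t ht
        obtain ⟨s, -, rfl⟩ := List.mem_map.mp ht
        change _ * Gr.body _ = (0 : ℝ)
        rw [body_monomialShift, mul_zero]
    · change Sections.value p q x (Φ.pullback V (1 ⊗ₜ gen l)) = _
      rw [pullback_one_tmul_gen, Sections.value_of_odd x (Φ.oddSection_mem _ l),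
        Sections.value_of_odd _ (Sections.tmul_mem _ (gen_mem l))]
  exact DFunLike.congr_fun this s

/-- The morphism with the given coordinates. -/
def toMorphism : Morphism p q m n where
  base := Φ.base
  pullback := Φ.pullback
  pullback_restrict := Φ.pullback_restrict
  pullback_local x s hs := (Φ.value_pullback x s).trans hs

/-- By `shiftList_coord` the pullback of x_k is the k-th component of the underlying map plus all
shifts in direction k; the generic point turns these into the body and the nilpotent part of the
prescribed value. -/
lemma coordMap_toMorphism_fst (a : Fin p → ℝ) (k : Fin m) :
    ((coordMap Φ.toMorphism.toNatTrans q (ofReal a (gens q))).1 k : Gr q) = Φ.even k a := by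
  have hle : (⊤ : Opens (Fin p → ℝ)) ≤ Opens.comap Φ.base ⊤ := (map_top _).ge
  rw [coordMap_toNatTrans_fst]
  change toPoint _ (Sections.restrict p q hle (Φ.pullback ⊤ (SmoothFun.coord k ⊗ₜ 1))) = _
  rw [pullback_tmul_one, pullbackSmooth, shiftList_coord _ _ _ _ SmoothFun.partialDeriv_coord,
    List.map_map]
  have h := sum_toList_prod (fun t : Fin m × Finset (Fin q) =>
    (Φ.evenShift (Opens.comap Φ.base ⊤) t).val) k
  rw [show ((Finset.univ : Finset (Fin m × Finset (Fin q))).toList.map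
      ((fun t : Fin m × CentralSqZero (Sections p q (Opens.comap Φ.base ⊤)) =>
        if t.1 = k then t.2.val else 0) ∘ fun t => (t.1, Φ.evenShift _ t))).sum = _ from h,
    map_add, map_add, map_sum, map_sum]
  have h1 : ∀ S, toPoint (ofReal a (gens q)) (Sections.restrict p q hle
      (Φ.evenShift (Opens.comap Φ.base ⊤) (k, S)).val) =
      (monomialShift ((monomialBasis q).repr (Φ.even k a) S) S).val := fun S => by
    rw [monomialShift_eq_smul]
    exact Sections.toPoint_ofReal_gens_restrict _ a _ _
  have h2 := Sections.toPoint_ofReal_gens_restrict (q := q) hle a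
      (SmoothFun.comp Φ.base Φ.contDiff_base ⊤ (SmoothFun.coord k)) 1
  rw [Finset.sum_congr rfl fun S _ => h1 S, sum_monomialShift (Φ.even_mem k a)]
  refine (congrArg (· + nil (Φ.even k a)) h2).trans ?_
  rw [← Algebra.algebraMap_eq_smul_one]
  refine (congrArg (fun r => algebraMap ℝ (Gr q) r + _)
    (SmoothFun.eval_comp Φ.base Φ.contDiff_base ⊤ (SmoothFun.coord k) ⟨a, trivial⟩)).trans ?_
  exact body_add_nil _

lemma coordMap_toMorphism_snd (a : Fin p → ℝ) (l : Fin n) :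
    ((coordMap Φ.toMorphism.toNatTrans q (ofReal a (gens q))).2 l : Gr q) = Φ.odd l a := by
  rw [coordMap_toNatTrans_snd]
  change toPoint _ (Sections.restrict p q _ (Φ.pullback ⊤ (1 ⊗ₜ gen l))) = _
  rw [pullback_one_tmul_gen, oddSection, map_sum, map_sum]
  conv_rhs => rw [← (monomialBasis q).sum_repr (Φ.odd l a)]
  exact Finset.sum_congr rfl fun S _ => Sections.toPoint_ofReal_gens_restrict _ a _ _

end MorphismData

/-! ### Smooth natural transformations come from morphisms -/

section

attribute [local instance] Gr.normedAddCommGroup Gr.normedSpace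

variable {p q m n : ℕ}

lemma contDiff_repr_ofReal {g : CoordSpace p q q → Gr q} (hg : ContDiff ℝ ∞ g)
    (S : Finset (Fin q)) :
    ContDiff ℝ ∞ fun a => (monomialBasis q).repr (g (ofReal a (gens q))) S := by
  let L : (Fin p → ℝ) →ₗ[ℝ] CoordSpace p q q :=
    ∑ i, (LinearMap.proj i).smulRight (evenDir i ⟨1, one_mem_even⟩)
  have h : ∀ a, (ofReal a (gens q) : CoordSpace p q q) = L a + ofReal 0 (gens q) := fun a => by
    ext k
    · simp [L, evenDir_fst, Algebra.algebraMap_eq_smul_one, LinearMap.sum_apply, Prod.fst_sum]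
    · simp [L, LinearMap.sum_apply, Prod.snd_sum]
  rw [funext fun a => congrArg (fun u => (monomialBasis q).repr (g u) S) (h a)]
  exact (LinearMap.toContinuousLinearMap ((monomialBasis q).coord S)).contDiff.comp
    (hg.comp ((LinearMap.toContinuousLinearMap L).contDiff.add contDiff_const))

/-- `Λ_0`-smooth natural transformations that agree at the points with real even coordinates are
equal. -/
lemma natTrans_ext_of_evenSmooth {α β : points p q ⟶ points m n}
    (hα : ∀ A, IsEvenSmooth (fun x : (points p q).obj A => α.app A x))
    (hβ : ∀ A, IsEvenSmooth (fun x : (points p q).obj A => β.app A x))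
    (h : ∀ a, coordMap α q (ofReal a (gens q)) = coordMap β q (ofReal a (gens q))) : α = β := by
  simp only [isEvenSmooth_iff] at hα hβ
  refine natTrans_ext fun N u => ?_
  ext k
  · have := NatFun.eq_zero_of_evenSmooth
      (g := ⟨fun N u => ((coordMap α N u).1 k : Gr N) - (coordMap β N u).1 k, fun N N' ρ u => by
        dsimp only
        rw [coordMap_map, coordMap_map, map_sub]; rfl⟩)
      (fun N => ((hα ⟨N⟩).1 k).sub ((hβ ⟨N⟩).1 k)) (fun a => sub_eq_zero.mpr (by rw [h]))
    exact sub_eq_zero.mp (congrFun (congrFun (congrArg Subtype.val this) N) u)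
  · have := NatFun.eq_zero_of_evenSmooth
      (g := ⟨fun N u => ((coordMap α N u).2 k : Gr N) - (coordMap β N u).2 k, fun N N' ρ u => by
        dsimp only
        rw [coordMap_map, coordMap_map, map_sub]; rfl⟩)
      (fun N => ((hα ⟨N⟩).2 k).sub ((hβ ⟨N⟩).2 k)) (fun a => sub_eq_zero.mpr (by rw [h]))
    exact sub_eq_zero.mp (congrFun (congrFun (congrArg Subtype.val this) N) u)

/-- A natural transformation comes from a morphism of supermanifolds if and only if it is
`Λ_0`-smooth. -/
theorem exists_toNatTrans_eq_iff (α : points p q ⟶ points m n) :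
    (∃ φ : Morphism p q m n, φ.toNatTrans = α) ↔
      ∀ A, IsEvenSmooth (fun x : (points p q).obj A => α.app A x) := by
  constructor
  · rintro ⟨φ, rfl⟩
    exact φ.isEvenSmooth_toNatTrans
  · intro hα
    have hq := (isEvenSmooth_iff α ⟨q⟩).mp (hα ⟨q⟩)
    -- The candidate is read off from α at the generic points over Λ_q alone; smoothness over Λ_q
    -- makes its coefficients smooth.
    let Φ : MorphismData p q m n :=
      { even := fun k a => (coordMap α q (ofReal a (gens q))).1 k
        odd := fun l a => (coordMap α q (ofReal a (gens q))).2 l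
        even_mem := fun _ _ => Subtype.prop _
        odd_mem := fun _ _ => Subtype.prop _
        contDiff_even := fun k S => contDiff_repr_ofReal (hq.1 k).1 S
        contDiff_odd := fun l S => contDiff_repr_ofReal (hq.2 l).1 S }
    -- The induced transformation is Λ_0-smooth by the direct implication, so agreement at the
    -- generic points suffices.
    refine ⟨Φ.toMorphism, natTrans_ext_of_evenSmooth Φ.toMorphism.isEvenSmooth_toNatTrans hα
      fun a => ?_⟩
    ext k
    · exact Φ.coordMap_toMorphism_fst a k
    · exact Φ.coordMap_toMorphism_snd a k

end

end Super

end

theorem mainTheorem11 (p q m n : ℕ) :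
    (∃ e : (Super.points p q ⟶ Super.points m n) ≃
        (Fin m → Super.FormalSeries.parity p q 0) × (Fin n → Super.FormalSeries.parity p q 1),
      ∀ (α : Super.points p q ⟶ Super.points m n) (A : Super.GrassmannAlg)
        (x : (Super.points p q).obj A),
        (∀ k, ((Super.coords (α.app A x)).1 k : Super.Gr A.gens) =
          Super.FormalSeries.evalAt ((e α).1 k) (Super.coords x)) ∧
        (∀ l, ((Super.coords (α.app A x)).2 l : Super.Gr A.gens) =
          Super.FormalSeries.evalAt ((e α).2 l) (Super.coords x))) ∧
    (∀ α : Super.points p q ⟶ Super.points m n,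
      (∃ φ : Super.Morphism p q m n, φ.toNatTrans = α) ↔
        ∀ A : Super.GrassmannAlg,
          Super.IsEvenSmooth (fun x : (Super.points p q).obj A => α.app A x)) :=
  ⟨Super.exists_equiv_formalSeries p q m n, Super.exists_toNatTrans_eq_iff⟩
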